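/- Let $\Gamma\subset\mathbb R^2\cong\mathbb C$ be a simple closed curve with a regular, real-analytic, $2\pi$-periodic parametrization $\zeta=\mathrm x_1+i\mathrm x_2$ (so $\zeta'\neq0$ everywhere and $\zeta$ is injective on $[0,2\pi)$), with unit normal $n=(\mathrm{Im}\,\zeta',-\mathrm{Re}\,\zeta')/|\zeta'|$, and let $\phi:\mathbb R\to\mathbb R$ be real-analytic and $2\pi$-periodic. Let $$\tilde S[\phi](t)=-\frac1{2\pi}\int_0^{2\pi}\log|\zeta(t)-\zeta(\tau)|\,\phi(\tau)\,|\zeta'(\tau)|\,d\tau$$ be the single-layer operator. For $M\ge 0$ let $U(z,\zeta(t))=\mathrm{Re}\sum_{j=1}^{M+1}\frac{c_j(t)}{j!}(z-\zeta(t))^j$, where $c(t)=(c_1(t),\dots,c_{M+1}(t))$ solves $A(t)B(t)c(t)=i\,(\phi(t),\phi'(t),\dots,\phi^{(M)}(t))^T$; here $A_{k,j}=\binom{k-1}{j-1}\frac{d^{k-j}}{dt^{k-j}}\frac1{|\zeta'(t)|}$ for $k\ge j$ and $0$ for $k<j$, and $B_{k,j}$ is the partial Bell polynomial $\mathbb B_{k,j}(\zeta'(t),\dots,\zeta^{(k-j+1)}(t))$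 ($0$ for $k<j$), $1\le k,j\le M+1$. Put $P(\tau,t)=U(\zeta(\tau),\zeta(t))$ and $Q(\tau,t)=\nabla_z U(\zeta(\tau),\zeta(t))\cdot n(\tau)$, and $$R^{(P)}(\tau,t)=\frac1{2\pi}\frac{(\zeta(t)-\zeta(\tau))\cdot n(\tau)}{|\zeta(t)-\zeta(\tau)|^2}P(\tau,t),\qquad R^{(Q)}(\tau,t)=-\frac1{2\pi}\log|\zeta(t)-\zeta(\tau)|\,\{\phi(\tau)-Q(\tau,t)\}$$ for $\tau\not\equiv t$ modulo $2\pi$, and $R^{(P)}(\tau,t)=-\frac{\zeta''(t)\cdot n(t)}{4\pi|\zeta'(t)|^2}P(t,t)$, $R^{(Q)}(\tau,t)=0$ for $\tau\equiv t$. For an integer $N\ge1$ let $h=\pi/N$, $t_j=jh$, let $T_N[F]=h\sum_{j=0}^{2N-1}F(t_j)$ be the trapezoidal rule, and let $$\tilde S_{M,N}[\phi](t)=\frac{P(t,t)}2+T_N\big[\{R^{(P)}(\cdot,t)+R^{(Q)}(\cdot,t)\}|\zeta'|\big].$$ Then for every integer $m\ge0$: 1. For $M=2m+1$ there is a constant $C$,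 depending only on $\zeta,\phi,m$, such that $|\tilde S[\phi](t)-\tilde S_{M,N}[\phi](t)|\le C h^{2m+3}$ for all $N\ge1$ and $t\in[0,2\pi]$. 2. For $M=2m$ there is a constant $C$, depending only on $\zeta,\phi,m$, such that $|\tilde S[\phi](t_k)-\tilde S_{M,N}[\phi](t_k)|\le C h^{2m+3}$ for all $N\ge1$ and all grid points $t_k$, $0\le k<2N$. 3. For $M=2m$ there is a function $g$ with $[\phi(\tau)-Q(\tau,t)]\,|\zeta'(\tau)|=\sin^{2m+1}(\frac{\tau-t}2)\,g(\tau,t)$ for all $\tau,t\in\mathbb R$, where $g(\cdot,t)$ is analytic and $g(\tau+2\pi,t)=-g(\tau,t)$, such that the function $$\sigma_t(\tau)=-\frac{g(t,t)}{4\pi}\sin^{2m+1}\big(\tfrac{\tau-t}2\big)\cos\big(\tfrac{\tau-t}2\big)\log\big(4\sin^2\tfrac{\tau-t}2\big)$$ ($0$ for $\tau\equiv t$) is continuous, $2\pi$-periodic, odd about $\tau=t$ and has integral $0$ over $[0,2\pi]$; for every grid point $t=t_k$ it is integrated exactly by the rule, $T_N[\sigma_{t_k}]=0$; and the trapezoidal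 rule applied to the remainder $R^{(Q)}(\cdot,t)|\zeta'|-\sigma_t$ has an error of at most $C h^{2m+3}$ for all $N\ge1$ and $t\in[0,2\pi]$, with $C$ depending only on $\zeta,\phi,m$. -/

import Mathlib

open Real

noncomputable section

namespace HDI

/-- `ζ = x₁ + i x₂` is a regular, analytic, `2π`-periodic parametrization of a simple closed curve
in the plane, the plane being identified with `ℂ`. -/
structure IsAnalyticClosedCurve (ζ : ℝ → ℂ) : Prop where
  analytic : AnalyticOnNhd ℝ ζ Set.univ
  periodic : Function.Periodic ζ (2 * π)
  regular : ∀ t, deriv ζ t ≠ 0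
  simple : Set.InjOn ζ (Set.Ico 0 (2 * π))

/-- A real-valued analytic `2π`-periodic density (in the parameter). -/
structure IsAnalyticDensity (φ : ℝ → ℝ) : Prop where
  analytic : AnalyticOnNhd ℝ φ Set.univ
  periodic : Function.Periodic φ (2 * π)

/-- Free-space Green function of the Laplace equation in the plane. -/
def green (x y : ℂ) : ℝ := -(1 / (2 * π)) * log ‖x - y‖

/-- The single-layer operator in the parameter space. -/
def singleLayer (ζ : ℝ → ℂ) (φ : ℝ → ℝ) (t : ℝ) : ℝ :=
  ∫ τ in (0 : ℝ)..(2 * π), green (ζ t) (ζ τ) * φ τ * ‖deriv ζ τ‖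

/-- The unit normal `(Im ζ', -Re ζ') / |ζ'|`. -/
def normal (ζ : ℝ → ℂ) (t : ℝ) : ℂ := ⟨(deriv ζ t).im / ‖deriv ζ t‖, -(deriv ζ t).re / ‖deriv ζ t‖⟩

/-- The partial Bell polynomial `𝔹_{m,j}(x 1, x 2, …)`, by the standard recurrence
`𝔹_{m+1,j+1} = ∑ i, (m choose i) x_{i+1} 𝔹_{m-i,j}`. The first numerical argument is `j`. -/
def partialBell (x : ℕ → ℂ) : ℕ → ℕ → ℂ
  | 0, m => if m = 0 then 1 else 0
  | _ + 1, 0 => 0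
  | j + 1, m + 1 =>
      ∑ i ∈ Finset.range (m + 1), (m.choose i : ℂ) * x (i + 1) * partialBell x j (m - i)

/-- The Bell matrix, of size `J = M + 1`; rows and columns are numbered from `0` here, so that the
entry `(i, k)` is `𝔹_{i+1,k+1}(ζ'(t), ζ''(t), …)`. -/
def bellMatrix (ζ : ℝ → ℂ) (M : ℕ) (t : ℝ) : Matrix (Fin (M + 1)) (Fin (M + 1)) ℂ :=
  Matrix.of fun i k => partialBell (fun n => iteratedDeriv n ζ t) (k + 1) (i + 1)

/-- The lower triangular matrix of the Leibniz rule for multiplication by `1 / |ζ'|`. -/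
def leibnizMatrix (ζ : ℝ → ℂ) (M : ℕ) (t : ℝ) : Matrix (Fin (M + 1)) (Fin (M + 1)) ℂ :=
  Matrix.of fun i k =>
    if (i : ℕ) < k then 0
    else ((i : ℕ).choose k : ℂ) *
      ((iteratedDeriv ((i : ℕ) - k) (fun s => 1 / ‖deriv ζ s‖) t : ℝ) : ℂ)

/-- The coefficients `c₁(t), …, c_{M+1}(t)` of the harmonic interpolant (the entry `k` is
`c_{k+1}(t)`): the solution of `A(t) B(t) c(t) = i (φ(t), φ'(t), …, φ^{(M)}(t))`, which says that
`|ζ'(τ)|⁻¹ ∂f/∂τ - i φ(τ)` vanishes at `τ = t` together with its first `M` derivatives. -/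
def coeff (ζ : ℝ → ℂ) (φ : ℝ → ℝ) (M : ℕ) (t : ℝ) : Fin (M + 1) → ℂ :=
  (leibnizMatrix ζ M t * bellMatrix ζ M t)⁻¹.mulVec
    fun i => Complex.I * ((iteratedDeriv i φ t : ℝ) : ℂ)

/-- The harmonic interpolating function `U_S(z, ζ(t)) = Re ∑_j c_j(t) (z - ζ(t))^j / j!`,
with `c₀ = 0`. -/
def harmonicInterp (ζ : ℝ → ℂ) (φ : ℝ → ℝ) (M : ℕ) (t : ℝ) (z : ℂ) : ℝ :=
  (∑ k : Fin (M + 1), coeff ζ φ M t k / (((k : ℕ) + 1).factorial : ℂ)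
    * (z - ζ t) ^ ((k : ℕ) + 1)).re

/-- Dirichlet trace `P_S(τ, t)` of the harmonic interpolating function. -/
def traceP (ζ : ℝ → ℂ) (φ : ℝ → ℝ) (M : ℕ) (τ t : ℝ) : ℝ :=
  harmonicInterp ζ φ M t (ζ τ)

/-- Neumann trace `Q_S(τ, t)` of the harmonic interpolating function. -/
def traceQ (ζ : ℝ → ℂ) (φ : ℝ → ℝ) (M : ℕ) (τ t : ℝ) : ℝ :=
  fderiv ℝ (harmonicInterp ζ φ M t) (ζ τ) (normal ζ τ)

open Classical in
/-- The regularized double-layer integrand `R_S^{(P)}(τ, t)`. On a simple closed curve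
`ζ τ = ζ t` means that `τ` and `t` agree modulo `2π`. -/
def kernelP (ζ : ℝ → ℂ) (φ : ℝ → ℝ) (M : ℕ) (τ t : ℝ) : ℝ :=
  if ζ τ = ζ t then
    -(inner ℝ (iteratedDeriv 2 ζ t) (normal ζ t) / (4 * π * ‖deriv ζ t‖ ^ 2)) * traceP ζ φ M t t
  else
    1 / (2 * π) * (inner ℝ (ζ t - ζ τ) (normal ζ τ) / ‖ζ t - ζ τ‖ ^ 2) * traceP ζ φ M τ t

open Classical in
/-- The regularized single-layer integrand `R_S^{(Q)}(τ, t)`. -/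
def kernelQ (ζ : ℝ → ℂ) (φ : ℝ → ℝ) (M : ℕ) (τ t : ℝ) : ℝ :=
  if ζ τ = ζ t then 0
  else -(1 / (2 * π)) * log ‖ζ t - ζ τ‖ * (φ τ - traceQ ζ φ M τ t)

/-- Mesh size `h = π / N`. -/
def mesh (N : ℕ) : ℝ := π / N

/-- Grid points `t_j = j h`. -/
def node (N j : ℕ) : ℝ := j * mesh N

/-- The trapezoidal rule with `2N` equispaced nodes for a `2π`-periodic integrand. -/
def trapezoid (N : ℕ) (F : ℝ → ℝ) : ℝ :=
  mesh N * ∑ j ∈ Finset.range (2 * N), F (node N j)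

/-- The trapezoidal-rule approximation of the regularized single-layer operator. -/
def singleLayerTrap (ζ : ℝ → ℂ) (φ : ℝ → ℝ) (M N : ℕ) (t : ℝ) : ℝ :=
  traceP ζ φ M t t / 2 +
    trapezoid N fun τ => (kernelP ζ φ M τ t + kernelQ ζ φ M τ t) * ‖deriv ζ τ‖

/-- The leading logarithmic term, with amplitude `a` and centre `t`. -/
def oddTerm (m : ℕ) (a t τ : ℝ) : ℝ :=
  -(a / (4 * π)) * sin ((τ - t) / 2) ^ (2 * m + 1) * cos ((τ - t) / 2)
    * log (4 * sin ((τ - t) / 2) ^ 2)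

end HDI

end

/-! Write `U = Re f` with `f` a polynomial in `z` that vanishes at `ζ t`. Then `P(t,t) = 0`, and the
regularized representation `S[φ](t) = ∫ (R^P + R^Q) |ζ'|` is Green's identity for `U`. On the curve
the difference of the two sides is the derivative of `Im (f log |ζ - ζ t|) - Im F` up to a constant
factor, where `F' = f / (z - ζ t)`. This primitive is continuous and periodic, so neither the
divergence theorem nor an orientation of the curve is needed (`integral_green_interp`,
`singleLayer_eq`).

The trapezoidal rule with `2N` nodes is exact on `e^{inτ}` unless `n` is a nonzero multiple of `2N`.
Hence Fourier coefficients of size `|n|^{-q}` give an error of order `h^q`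
(`FourierDecay.norm_quadErr_le`). With `s = τ - t`, the chord `ζ τ - ζ t` is `e^{is} - 1` times a
smooth nonvanishing periodic `q`. So `R^P |ζ'|` is smooth, and `R^Q |ζ'|` is smooth up to `-(1/2π)
log |e^{is} - 1|` times the residual `(φ - Q) |ζ'|`. The linear system for the coefficients makes
the residual vanish to order `M + 1` at `s = 0`, so it is `(e^{is} - 1)^{M+1}` times a smooth
family. Since `(e^{is} - 1)^n log |e^{is} - 1|` has coefficients of size `|k|^{-n-1}`
(`fourierDecay_log_norm`), the error is of order `h^{M+2}`. Joint smoothness and compactness make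
all constants uniform in `t`.

For `M = 2m` this is one order short. Subtracting `σ_t` replaces the residual by a family divisible
by one more power of `e^{is} - 1` (`exists_odd_splitting`), and the rule restores the missing order
at grid points: `σ_t` is odd about `t`, so its integral vanishes, and so does its sum over a grid
that is symmetric about `t`. -/

namespace HDI

open MeasureTheory

/-! ### Trigonometric series with algebraically decaying coefficients -/

/-- The exponential `τ ↦ exp (i n τ)`. -/
noncomputable def character (n : ℤ) (τ : ℝ) : ℂ := Complex.exp (n * τ * Complex.I)

theorem norm_character (n : ℤ) (τ : ℝ) : ‖character n τ‖ = 1 := by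
  have : character n τ = Complex.exp (((n * τ : ℝ) : ℂ) * Complex.I) := by
    simp [character]
  rw [this, Complex.norm_exp_ofReal_mul_I]

theorem continuous_character (n : ℤ) : Continuous (character n) := by
  unfold character; fun_prop

theorem character_zero (τ : ℝ) : character 0 τ = 1 := by simp [character]

theorem character_add_left (m n : ℤ) (τ : ℝ) :
    character (m + n) τ = character m τ * character n τ := by
  simp only [character, ← Complex.exp_add]; push_cast; ring_nf

theorem character_add_right (n : ℤ) (τ σ : ℝ) :
    character n (τ + σ) = character n τ * character n σ := by
  simp only [character, ← Complex.exp_add]; push_cast; ring_nf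

theorem character_natCast (k : ℕ) (τ : ℝ) : character k τ = character 1 τ ^ k := by
  simp only [character, ← Complex.exp_nat_mul]; push_cast; ring_nf

theorem conj_character (n : ℤ) (τ : ℝ) :
    (starRingEnd ℂ) (character n τ) = character (-n) τ := by
  simp only [character, ← Complex.exp_conj]; simp

theorem _root_.HasSum.congr_terms {ι : Type*} {f g : ι → ℂ} {x : ℂ} (hf : HasSum f x)
    (h : ∀ i, g i = f i) : HasSum g x := (funext h : g = f) ▸ hf

/-- The weight sum `∑ (1 + |n|)^{-q}`. -/
noncomputable def decaySum (q : ℕ) : ℝ := ∑' n : ℤ, 1 / (1 + |(n : ℝ)|) ^ q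

theorem summable_decay {q : ℕ} (hq : 2 ≤ q) :
    Summable fun n : ℤ => 1 / (1 + |(n : ℝ)|) ^ q := by
  have h : Summable fun n : ℕ => 1 / (1 + (n : ℝ)) ^ q := by
    have := (summable_nat_add_iff 1).2 (Real.summable_one_div_nat_pow.2 (show 1 < q by omega))
    refine this.congr fun n => ?_
    push_cast; ring
  refine Summable.of_nat_of_neg ?_ ?_ <;> simpa using h

/-- `F` is the sum of a trigonometric series with coefficients of size `A (1 + |n|)^{-q}`. -/
def FourierDecay (q : ℕ) (A : ℝ) (F : ℝ → ℂ) : Prop :=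
  ∃ a : ℤ → ℂ, (∀ n, ‖a n‖ ≤ A * (1 / (1 + |(n : ℝ)|) ^ q)) ∧
    ∀ τ, HasSum (fun n => a n * character n τ) (F τ)

namespace FourierDecay

variable {q : ℕ} {A B : ℝ} {F G : ℝ → ℂ}

theorem nonneg (h : FourierDecay q A F) : 0 ≤ A := by
  obtain ⟨a, ha, -⟩ := h
  simpa using (norm_nonneg _).trans (ha 0)

theorem add (hF : FourierDecay q A F) (hG : FourierDecay q B G) :
    FourierDecay q (A + B) fun τ => F τ + G τ := by
  obtain ⟨a, ha, hs⟩ := hF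
  obtain ⟨b, hb, hs'⟩ := hG
  refine ⟨fun n => a n + b n, fun n => ?_, fun τ => ?_⟩
  · rw [add_mul]; exact (norm_add_le _ _).trans (add_le_add (ha n) (hb n))
  · simpa only [add_mul] using (hs τ).add (hs' τ)

theorem const_mul (hF : FourierDecay q A F) (c : ℂ) :
    FourierDecay q (‖c‖ * A) fun τ => c * F τ := by
  obtain ⟨a, ha, hs⟩ := hF
  refine ⟨fun n => c * a n, fun n => ?_, fun τ => ?_⟩
  · rw [norm_mul, mul_assoc]; exact mul_le_mul_of_nonneg_left (ha n) (norm_nonneg _)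
  · simpa only [mul_assoc] using (hs τ).mul_left c

/-- Translation only rotates the phases of the coefficients. The unchanged constant `A` is what
makes estimates in `τ - t` uniform in `t`. -/
theorem translate (hF : FourierDecay q A F) (t : ℝ) :
    FourierDecay q A fun τ => F (τ - t) := by
  obtain ⟨a, ha, hs⟩ := hF
  refine ⟨fun n => a n * character n (-t), fun n => ?_, fun τ => ?_⟩
  · rw [norm_mul, norm_character, mul_one]; exact ha n
  · convert hs (τ - t) using 2 with n
    rw [sub_eq_add_neg, character_add_right]; ring

theorem conj (hF : FourierDecay q A F) :
    FourierDecay q A fun τ => (starRingEnd ℂ) (F τ) := by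
  obtain ⟨a, ha, hs⟩ := hF
  refine ⟨fun n => (starRingEnd ℂ) (a (-n)), fun n => ?_, fun τ => ?_⟩
  · simpa using ha (-n)
  · have := (Complex.hasSum_conj'.2 (hs τ))
    rw [← (Equiv.neg ℤ).hasSum_iff] at this
    convert this using 2 with n
    simp [conj_character]

theorem one_add_abs_add_le (m n : ℝ) : 1 + |m + n| ≤ (1 + |m|) * (1 + |n|) := by
  nlinarith [abs_add_le m n, abs_nonneg m, abs_nonneg n, mul_nonneg (abs_nonneg m) (abs_nonneg n)]

/-- Submultiplicativity of the weight. -/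
theorem one_div_weight_le (q : ℕ) (n l : ℤ) :
    1 / (1 + |((n - l : ℤ) : ℝ)|) ^ q ≤ (1 + |(l : ℝ)|) ^ q * (1 / (1 + |(n : ℝ)|) ^ q) := by
  have h := one_add_abs_add_le ((n - l : ℤ) : ℝ) l
  have h' : ((n - l : ℤ) : ℝ) + l = n := by push_cast; ring
  rw [h'] at h
  rw [mul_one_div, div_le_div_iff₀ (by positivity) (by positivity), one_mul, ← mul_pow, mul_comm]
  gcongr

theorem mul_character (hF : FourierDecay q A F) (l : ℤ) :
    FourierDecay q (A * (1 + |(l : ℝ)|) ^ q) fun τ => F τ * character l τ := by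
  have hA := hF.nonneg
  obtain ⟨a, ha, hs⟩ := hF
  refine ⟨fun n => a (n - l), fun n => ?_, fun τ => ?_⟩
  · refine (ha _).trans ?_
    rw [mul_assoc]
    exact mul_le_mul_of_nonneg_left (one_div_weight_le q n l) hA
  · have := (hs τ).mul_right (character l τ)
    rw [← (Equiv.subRight l).hasSum_iff] at this
    refine this.congr_terms fun n => ?_
    change _ = a (n - l) * character (n - l) τ * character l τ
    rw [mul_assoc, ← character_add_left, sub_add_cancel]

theorem summable_norm (hq : 2 ≤ q) {a : ℤ → ℂ}
    (ha : ∀ n, ‖a n‖ ≤ A * (1 / (1 + |(n : ℝ)|) ^ q)) : Summable fun n => ‖a n‖ :=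
  Summable.of_nonneg_of_le (fun _ => norm_nonneg _) ha ((summable_decay hq).mul_left A)

/-- The coefficients are convolved. Moving the weight from `n - l` to `n` costs `(1 + |l|)^q`; the
two further powers in the decay of `G` keep the sum over `l` finite. -/
theorem mul (hq : 2 ≤ q) (hF : FourierDecay q A F) (hG : FourierDecay (q + 2) B G) :
    FourierDecay q (A * B * decaySum 2) fun τ => F τ * G τ := by
  have hA := hF.nonneg
  have hB := hG.nonneg
  obtain ⟨a, ha, hs⟩ := hF
  obtain ⟨b, hb, hs'⟩ := hG
  have key : ∀ n l : ℤ, ‖a (n - l) * b l‖ ≤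
      A * B * (1 / (1 + |(n : ℝ)|) ^ q) * (1 / (1 + |(l : ℝ)|) ^ 2) := by
    intro n l
    rw [norm_mul]
    calc ‖a (n - l)‖ * ‖b l‖
        ≤ (A * ((1 + |(l : ℝ)|) ^ q * (1 / (1 + |(n : ℝ)|) ^ q)))
            * (B * (1 / (1 + |(l : ℝ)|) ^ (q + 2))) := by
          refine mul_le_mul ((ha _).trans ?_) (hb l) (norm_nonneg _) (by positivity)
          exact mul_le_mul_of_nonneg_left (one_div_weight_le q n l) hA
      _ = _ := by
          have : (1 + |(l : ℝ)|) ≠ 0 := by positivity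
          rw [pow_add]; field_simp
  have hsl : ∀ n : ℤ, Summable fun l => ‖a (n - l) * b l‖ := fun n =>
    Summable.of_nonneg_of_le (fun _ => norm_nonneg _) (key n)
      ((summable_decay le_rfl).mul_left _)
  refine ⟨fun n => ∑' l, a (n - l) * b l, fun n => ?_, fun τ => ?_⟩
  · refine (norm_tsum_le_tsum_norm (hsl n)).trans ?_
    refine ((hsl n).tsum_le_tsum (key n) ((summable_decay le_rfl).mul_left _)).trans ?_
    rw [tsum_mul_left, decaySum]
    exact le_of_eq (by ring)
  · have hsa := summable_norm hq ha
    have hsb := summable_norm (by omega) hb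
    have h1 : Summable fun n => ‖a n * character n τ‖ := by simpa [norm_character] using hsa
    have h2 : Summable fun n => ‖b n * character n τ‖ := by simpa [norm_character] using hsb
    have hp : HasSum (fun p : ℤ × ℤ => (a p.1 * character p.1 τ) * (b p.2 * character p.2 τ))
        (F τ * G τ) := by
      have h3 := summable_mul_of_summable_norm h1 h2
      have := h1.of_norm.tsum_mul_tsum h2.of_norm h3
      rw [(hs τ).tsum_eq, (hs' τ).tsum_eq] at this
      exact this ▸ h3.hasSum
    -- The double series is regrouped by total frequency: the fibre over `n` holds the pairs `(n -
    -- l, l)`.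
    let e : ℤ × ℤ ≃ ℤ × ℤ :=
      { toFun := fun p => (p.1 - p.2, p.2), invFun := fun p => (p.1 + p.2, p.2),
        left_inv := fun p => by simp, right_inv := fun p => by simp }
    rw [← e.hasSum_iff] at hp
    refine hp.prod_fiberwise fun n => ?_
    have := ((hsl n).of_norm.hasSum).mul_right (character n τ)
    refine this.congr_terms fun l => ?_
    change a (n - l) * character (n - l) τ * (b l * character l τ) = _
    have : character n τ = character (n - l) τ * character l τ := by
      rw [← character_add_left, sub_add_cancel]
    rw [this]; ring

end FourierDecay

/-! ### The error of the trapezoidal rule -/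

/-- The quadrature error of the trapezoidal rule for complex-valued functions. -/
noncomputable def quadErr (N : ℕ) (F : ℝ → ℂ) : ℂ :=
  (∫ τ in (0 : ℝ)..(2 * π), F τ) - mesh N * ∑ j ∈ Finset.range (2 * N), F (node N j)

theorem quadErr_ofReal (N : ℕ) (F : ℝ → ℝ) :
    quadErr N (fun τ => (F τ : ℂ)) =
      (((∫ τ in (0 : ℝ)..(2 * π), F τ) - trapezoid N F : ℝ) : ℂ) := by
  simp [quadErr, trapezoid, intervalIntegral.integral_ofReal]

theorem integral_character {n : ℤ} (hn : n ≠ 0) :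
    ∫ τ in (0 : ℝ)..(2 * π), character n τ = 0 := by
  have hc : (n : ℂ) * Complex.I ≠ 0 := mul_ne_zero (by exact_mod_cast hn) Complex.I_ne_zero
  have : (fun τ : ℝ => character n τ) = fun τ : ℝ => Complex.exp (n * Complex.I * τ) := by
    funext τ; simp only [character]; ring_nf
  rw [this, integral_exp_mul_complex hc]
  have : Complex.exp (n * Complex.I * ((2 * π : ℝ) : ℂ)) = 1 := by
    rw [Complex.exp_eq_one_iff]; exact ⟨n, by push_cast; ring⟩
  rw [this]; simp

/-- The node values are the powers of `r = e^{inh}`, a `2N`-th root of unity, so their geometric sum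
vanishes unless `r = 1`, that is, unless `2N` divides `n`. -/
theorem norm_quadErr_character_le {N : ℕ} (hN : 0 < N) (n : ℤ) :
    ‖quadErr N (character n)‖ ≤ if n ≠ 0 ∧ (2 * N : ℤ) ∣ n then 2 * π else 0 := by
  have hN' : (N : ℝ) ≠ 0 := by positivity
  have hNc : (N : ℂ) ≠ 0 := by exact_mod_cast hN.ne'
  have hπ : (π : ℂ) ≠ 0 := by exact_mod_cast Real.pi_ne_zero
  set r : ℂ := character n (mesh N) with hr
  have hnode : ∀ j : ℕ, character n (node N j) = r ^ j := by
    intro j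
    simp only [hr, character, node, ← Complex.exp_nat_mul]; push_cast; ring_nf
  have hpow : r ^ (2 * N) = 1 := by
    rw [← hnode, character, Complex.exp_eq_one_iff]
    refine ⟨n, ?_⟩
    simp only [node, mesh]; push_cast; field_simp
  have hone : r = 1 ↔ (2 * N : ℤ) ∣ n := by
    rw [hr, character, Complex.exp_eq_one_iff]
    refine exists_congr fun k => ?_
    simp only [mesh]
    constructor
    · intro h
      have h' : (n : ℂ) = (2 * N * k : ℤ) := by
        have hI := Complex.I_ne_zero
        push_cast at h ⊢
        field_simp at h
        linear_combination h
      exact_mod_cast h'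
    · rintro rfl
      push_cast; field_simp
  have hsum : ∑ j ∈ Finset.range (2 * N), character n (node N j)
      = if (2 * N : ℤ) ∣ n then (2 * N : ℂ) else 0 := by
    simp_rw [hnode]
    split_ifs with h
    · rw [hone.2 h]; simp
    · have := mt hone.1 h
      rw [geom_sum_eq this, hpow]; simp
  rw [quadErr, hsum]
  by_cases h0 : n = 0
  · subst h0
    have : (fun τ : ℝ => character 0 τ) = fun _ => (1 : ℂ) := funext character_zero
    simp only [this]
    simp [mesh]
    field_simp; simp
  · rw [integral_character h0]
    split_ifs with h1 h2 h2
    · have : (mesh N : ℂ) * (2 * N) = ((2 * π : ℝ) : ℂ) := by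
        simp only [mesh]; push_cast; field_simp
      rw [this, zero_sub, norm_neg, Complex.norm_real, Real.norm_of_nonneg (by positivity)]
    · exact absurd ⟨h0, h1⟩ h2
    · exact absurd h2.2 h1
    · simp

theorem hasSum_quadErr {q : ℕ} (hq : 2 ≤ q) {A : ℝ} {F : ℝ → ℂ} {a : ℤ → ℂ}
    (ha : ∀ n, ‖a n‖ ≤ A * (1 / (1 + |(n : ℝ)|) ^ q))
    (hs : ∀ τ, HasSum (fun n => a n * character n τ) (F τ)) (N : ℕ) :
    HasSum (fun n => a n * quadErr N (character n)) (quadErr N F) := by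
  have hsa := FourierDecay.summable_norm hq ha
  let f : ℤ → C(ℝ, ℂ) := fun n => ⟨fun τ => a n * character n τ,
    continuous_const.mul (continuous_character n)⟩
  have hint := intervalIntegral.hasSum_intervalIntegral_of_summable_norm (f := f) (a := 0)
    (b := 2 * π) (Summable.of_nonneg_of_le (fun _ => norm_nonneg _) (fun n => by
      refine (ContinuousMap.norm_le _ (norm_nonneg (a n))).2 fun x => ?_
      simp [f, norm_character]) hsa)
  have hF : ∀ τ, ∑' n, f n τ = F τ := fun τ => (hs τ).tsum_eq
  simp only [hF] at hint
  have hfin : HasSum (fun n => (mesh N : ℂ) *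
      ∑ j ∈ Finset.range (2 * N), a n * character n (node N j))
      ((mesh N : ℂ) * ∑ j ∈ Finset.range (2 * N), F (node N j)) :=
    (hasSum_sum fun j _ => hs (node N j)).mul_left _
  refine (hint.sub hfin).congr_terms fun n => ?_
  simp only [quadErr, f, ContinuousMap.coe_mk, intervalIntegral.integral_const_mul,
    ← Finset.mul_sum]
  ring

/-- Aliasing: only the frequencies `2Nj` with `j ≠ 0` contribute, and their weights carry a common
factor `N^{-q} = (h/π)^q`. -/
theorem FourierDecay.norm_quadErr_le {q : ℕ} (hq : 2 ≤ q) {A : ℝ} {F : ℝ → ℂ}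
    (hF : FourierDecay q A F) {N : ℕ} (hN : 0 < N) :
    ‖quadErr N F‖ ≤ 2 * π * decaySum q / π ^ q * A * mesh N ^ q := by
  have hA := hF.nonneg
  obtain ⟨a, ha, hs⟩ := hF
  have hN0 : (0 : ℝ) < N := by exact_mod_cast hN
  have hN1 : (1 : ℝ) ≤ N := by exact_mod_cast hN
  let w : ℤ → ℝ := fun n => if n ≠ 0 ∧ (2 * N : ℤ) ∣ n then
    2 * π * A * (1 / (1 + |(n : ℝ)|) ^ q) else 0
  have hw0 : ∀ n, 0 ≤ w n := fun n => by simp only [w]; split_ifs <;> positivity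
  have hws : Summable w := by
    refine Summable.of_nonneg_of_le hw0 (fun n => ?_)
      ((summable_decay hq).mul_left (2 * π * A))
    simp only [w]; split_ifs
    · exact le_rfl
    · positivity
  have hle : ∀ n, ‖a n * quadErr N (character n)‖ ≤ w n := by
    intro n
    rw [norm_mul]
    refine (mul_le_mul (ha n) (norm_quadErr_character_le hN n) (norm_nonneg _)
      (by positivity)).trans ?_
    simp only [w]; split_ifs
    · exact le_of_eq (by ring)
    · simp
  have h1 := tsum_of_norm_bounded hws.hasSum hle
  rw [(hasSum_quadErr hq ha hs N).tsum_eq] at h1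
  refine h1.trans ?_
  have hinj : Function.Injective fun j : ℤ => (2 * N : ℤ) * j := fun i j h => by
    have : (2 * N : ℤ) ≠ 0 := by positivity
    exact mul_left_cancel₀ this h
  have hsupp : Function.support w ⊆ Set.range fun j : ℤ => (2 * N : ℤ) * j := by
    intro n hn
    simp only [Function.mem_support, w] at hn
    by_contra hcon
    apply hn
    rw [if_neg]
    rintro ⟨-, k, rfl⟩
    exact hcon ⟨k, rfl⟩
  rw [← hinj.tsum_eq hsupp]
  have hbound : ∀ j : ℤ, w (2 * N * j) ≤
      (2 * π * A / (N : ℝ) ^ q) * (1 / (1 + |(j : ℝ)|) ^ q) := by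
    intro j
    simp only [w]
    split_ifs with h
    · have hj : 1 ≤ |(j : ℝ)| := by
        have : j ≠ 0 := fun h0 => h.1 (by simp [h0])
        exact_mod_cast Int.one_le_abs this
      -- Since `|j| ≥ 1`, `N (1 + |j|) ≤ 2N |j|`.
      have h2 : (N : ℝ) * (1 + |(j : ℝ)|) ≤ 1 + |((2 * N * j : ℤ) : ℝ)| := by
        push_cast
        rw [abs_mul, abs_of_pos (by positivity : (0 : ℝ) < 2 * N)]
        nlinarith
      calc 2 * π * A * (1 / (1 + |((2 * N * j : ℤ) : ℝ)|) ^ q)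
          ≤ 2 * π * A * (1 / ((N : ℝ) * (1 + |(j : ℝ)|)) ^ q) := by gcongr
        _ = _ := by rw [mul_pow]; field_simp
    · positivity
  have hs2 := (summable_decay hq).mul_left (2 * π * A / (N : ℝ) ^ q)
  refine (Summable.tsum_le_tsum hbound (hws.comp_injective hinj) hs2).trans (le_of_eq ?_)
  rw [tsum_mul_left, mesh, ← decaySum, div_pow]
  field_simp

end HDI

namespace HDI

open MeasureTheory
open scoped ContDiff

/-! ### Smooth periodic functions have rapidly decaying Fourier coefficients -/

/-- The Fourier coefficient of a `2π`-periodic function. -/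
noncomputable def fourierIntegral (F : ℝ → ℂ) (n : ℤ) : ℂ :=
  (1 / (2 * π) : ℝ) • ∫ τ in (0 : ℝ)..(2 * π), character (-n) τ * F τ

theorem norm_fourierIntegral_le {F : ℝ → ℂ} {K : ℝ} (h : ∀ τ, ‖F τ‖ ≤ K) (n : ℤ) :
    ‖fourierIntegral F n‖ ≤ K := by
  have h2 : (0 : ℝ) < 2 * π := by positivity
  have := intervalIntegral.norm_integral_le_of_norm_le_const (a := 0) (b := 2 * π)
    (f := fun τ => character (-n) τ * F τ) (C := K) fun τ _ => by
      rw [norm_mul, norm_character, one_mul]; exact h τ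
  rw [fourierIntegral, norm_smul, Real.norm_of_nonneg (by positivity)]
  rw [sub_zero, abs_of_pos h2] at this
  calc 1 / (2 * π) * _ ≤ 1 / (2 * π) * (K * (2 * π)) := by gcongr
    _ = K := by field_simp

theorem hasDerivAt_character (n : ℤ) (τ : ℝ) :
    HasDerivAt (character n) (n * Complex.I * character n τ) τ := by
  have h : HasDerivAt (fun τ : ℝ => (n : ℂ) * τ * Complex.I) ((n : ℂ) * 1 * Complex.I) τ :=
    ((Complex.ofRealCLM.hasDerivAt (x := τ)).const_mul (n : ℂ)).mul_const Complex.I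
  refine HasDerivAt.congr_deriv (f := character n) h.cexp ?_
  simp only [character]; ring

theorem character_two_pi (n : ℤ) : character n (2 * π) = 1 := by
  rw [character, Complex.exp_eq_one_iff]; exact ⟨n, by push_cast; ring⟩

theorem character_at_zero (n : ℤ) : character n 0 = 1 := by simp [character]

theorem fourierIntegral_deriv {F : ℝ → ℂ} (hF : ContDiff ℝ 1 F)
    (hp : Function.Periodic F (2 * π)) (n : ℤ) :
    fourierIntegral (deriv F) n = n * Complex.I * fourierIntegral F n := by
  have hd : ∀ τ, HasDerivAt (fun τ => character (-n) τ * F τ)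
      (-(n * Complex.I) * (character (-n) τ * F τ) + character (-n) τ * deriv F τ) τ := by
    intro τ
    refine HasDerivAt.congr_deriv ((hasDerivAt_character (-n) τ).mul
      ((hF.differentiable one_ne_zero) τ).hasDerivAt) ?_
    push_cast; ring
  have hc1 : Continuous fun τ => character (-n) τ * F τ :=
    (continuous_character _).mul hF.continuous
  have hc3 : Continuous fun τ => -(n * Complex.I) * (character (-n) τ * F τ) :=
    continuous_const.mul hc1
  have hc2 : Continuous fun τ => character (-n) τ * deriv F τ :=
    (continuous_character _).mul (hF.continuous_deriv le_rfl)
  have := intervalIntegral.integral_eq_sub_of_hasDerivAt (a := 0) (b := 2 * π)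
    (fun τ _ => hd τ) ((hc3.add hc2).intervalIntegrable _ _)
  rw [intervalIntegral.integral_add (hc3.intervalIntegrable _ _)
    (hc2.intervalIntegrable _ _), intervalIntegral.integral_const_mul, character_two_pi,
    character_at_zero, ← zero_add (2 * π), hp 0, sub_self, zero_add] at this
  have h3 := eq_neg_of_add_eq_zero_right this
  simp only [fourierIntegral]
  rw [h3]
  simp only [Complex.real_smul]; ring

theorem periodic_deriv {E : Type*} [NormedAddCommGroup E] [NormedSpace ℝ E] {F : ℝ → E} {c : ℝ}
    (hp : Function.Periodic F c) : Function.Periodic (deriv F) c := fun τ => by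
  rw [← deriv_comp_add_const]; congr 1; exact funext hp

theorem fourierIntegral_iteratedDeriv (k : ℕ) : ∀ {F : ℝ → ℂ}, ContDiff ℝ ∞ F →
    Function.Periodic F (2 * π) → ∀ n : ℤ,
    fourierIntegral (iteratedDeriv k F) n = (n * Complex.I) ^ k * fourierIntegral F n := by
  induction k with
  | zero => intro F _ _ n; simp
  | succ k ih =>
    intro F hF hp n
    have h1 : ContDiff ℝ ∞ (deriv F) := (contDiff_infty_iff_deriv.1 hF).2
    rw [iteratedDeriv_succ', ih h1 (periodic_deriv hp),
      fourierIntegral_deriv (hF.of_le (by exact_mod_cast le_top)) hp]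
    ring

theorem hasSum_fourierIntegral {F : ℝ → ℂ} (hF : Continuous F)
    (hp : Function.Periodic F (2 * π)) (hs : Summable (fourierIntegral F)) (τ : ℝ) :
    HasSum (fun n => fourierIntegral F n * character n τ) (F τ) := by
  have : Fact (0 < 2 * π) := ⟨by positivity⟩
  let f : C(AddCircle (2 * π), ℂ) := ⟨hp.lift, continuous_coinduced_dom.mpr hF⟩
  have hfour : ∀ (n : ℤ) (x : ℝ), fourier n (x : AddCircle (2 * π)) = character n x := by
    intro n x
    rw [fourier_coe_apply, character]
    congr 1
    have : (π : ℂ) ≠ 0 := by exact_mod_cast Real.pi_ne_zero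
    push_cast; field_simp
  have hco : ∀ n, fourierCoeff f n = fourierIntegral F n := by
    intro n
    rw [fourierCoeff_eq_intervalIntegral _ n 0, zero_add, fourierIntegral]
    simp only [hfour]
    rfl
  have := has_pointwise_sum_fourier_series_of_summable (f := f)
    (by rw [show fourierCoeff f = fourierIntegral F from funext hco]; exact hs) (τ : AddCircle _)
  refine HasSum.congr_terms this fun n => ?_
  rw [hco, hfour]; rfl

/-- Integrating by parts `q` times bounds `|n|^q` times the coefficient. The factor `2 ^ q` comes
from `1 + |n| ≤ 2 |n|` for `n ≠ 0`; the mean value needs the bound on `F` itself. -/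
theorem fourierDecay_of_contDiff {F : ℝ → ℂ} (hF : ContDiff ℝ ∞ F)
    (hp : Function.Periodic F (2 * π)) {q : ℕ} (hq : 2 ≤ q) {K : ℝ} (h0 : ∀ τ, ‖F τ‖ ≤ K)
    (h1 : ∀ τ, ‖iteratedDeriv q F τ‖ ≤ K) : FourierDecay q (K * 2 ^ q) F := by
  have hK : 0 ≤ K := (norm_nonneg _).trans (h0 0)
  have hb : ∀ n : ℤ, ‖fourierIntegral F n‖ ≤ K * 2 ^ q * (1 / (1 + |(n : ℝ)|) ^ q) := by
    intro n
    rcases eq_or_ne n 0 with rfl | hn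
    · refine (norm_fourierIntegral_le h0 0).trans ?_
      have : (1 : ℝ) ≤ 2 ^ q := one_le_pow₀ (by norm_num)
      simpa using le_mul_of_one_le_right hK this
    · have h := norm_fourierIntegral_le h1 n
      rw [fourierIntegral_iteratedDeriv q hF hp, norm_mul, norm_pow, norm_mul, Complex.norm_I,
        mul_one, Complex.norm_intCast] at h
      have hn1 : 1 ≤ |(n : ℝ)| := by exact_mod_cast Int.one_le_abs hn
      have h2 : (1 + |(n : ℝ)|) ^ q ≤ 2 ^ q * |(n : ℝ)| ^ q := by
        rw [← mul_pow]; gcongr; linarith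
      rw [mul_one_div, le_div_iff₀ (by positivity)]
      calc ‖fourierIntegral F n‖ * (1 + |(n : ℝ)|) ^ q
          ≤ ‖fourierIntegral F n‖ * (2 ^ q * |(n : ℝ)| ^ q) := by gcongr
        _ = 2 ^ q * (|(n : ℝ)| ^ q * ‖fourierIntegral F n‖) := by ring
        _ ≤ 2 ^ q * K := by gcongr
        _ = _ := by ring
  exact ⟨_, hb, hasSum_fourierIntegral hF.continuous hp
    (FourierDecay.summable_norm hq hb).of_norm⟩

/-! ### Smooth families of periodic functions -/

/-- A family `s ↦ F (s, t)` of `2π`-periodic functions that is jointly smooth. -/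
structure PeriodicSmooth (F : ℝ × ℝ → ℂ) : Prop where
  smooth : ContDiff ℝ ∞ F
  periodic : ∀ s t, F (s + 2 * π, t) = F (s, t)

namespace PeriodicSmooth

variable {F G : ℝ × ℝ → ℂ}

theorem section_contDiff (hF : PeriodicSmooth F) (t : ℝ) : ContDiff ℝ ∞ fun s => F (s, t) :=
  hF.smooth.comp (contDiff_id.prodMk contDiff_const)

theorem section_periodic (hF : PeriodicSmooth F) (t : ℝ) :
    Function.Periodic (fun s => F (s, t)) (2 * π) := fun s => hF.periodic s t

theorem contDiff_deriv_fst (hF : ContDiff ℝ ∞ F) :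
    ContDiff ℝ ∞ fun p : ℝ × ℝ => deriv (fun s => F (s, p.2)) p.1 := by
  have h : (fun p : ℝ × ℝ => deriv (fun s => F (s, p.2)) p.1) =
      fun p => fderiv ℝ F p (1, 0) := by
    funext p
    have h1 : HasFDerivAt F (fderiv ℝ F p) (p.1, p.2) :=
      (hF.differentiable (by simp) p).hasFDerivAt
    have h2 : HasDerivAt (fun s : ℝ => (s, p.2)) ((1 : ℝ), (0 : ℝ)) p.1 :=
      (hasDerivAt_id p.1).prodMk (hasDerivAt_const _ _)
    exact (h1.comp_hasDerivAt p.1 h2).deriv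
  rw [h]
  exact (hF.fderiv_right (m := ∞) (by simp)).clm_apply contDiff_const

theorem deriv_fst (hF : PeriodicSmooth F) :
    PeriodicSmooth fun p => deriv (fun s => F (s, p.2)) p.1 :=
  ⟨contDiff_deriv_fst hF.smooth, fun s t => periodic_deriv (hF.section_periodic t) s⟩

theorem const (c : ℂ) : PeriodicSmooth fun _ => c := ⟨contDiff_const, fun _ _ => rfl⟩

theorem add (hF : PeriodicSmooth F) (hG : PeriodicSmooth G) :
    PeriodicSmooth fun p => F p + G p :=
  ⟨hF.smooth.add hG.smooth, fun s t => by simp [hF.periodic s t, hG.periodic s t]⟩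

theorem sub (hF : PeriodicSmooth F) (hG : PeriodicSmooth G) :
    PeriodicSmooth fun p => F p - G p :=
  ⟨hF.smooth.sub hG.smooth, fun s t => by simp [hF.periodic s t, hG.periodic s t]⟩

theorem mul (hF : PeriodicSmooth F) (hG : PeriodicSmooth G) :
    PeriodicSmooth fun p => F p * G p :=
  ⟨hF.smooth.mul hG.smooth, fun s t => by simp [hF.periodic s t, hG.periodic s t]⟩

theorem pow (hF : PeriodicSmooth F) (n : ℕ) : PeriodicSmooth fun p => F p ^ n :=
  ⟨hF.smooth.pow n, fun s t => by simp [hF.periodic s t]⟩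

theorem div (hF : PeriodicSmooth F) (hG : PeriodicSmooth G) (h : ∀ p, G p ≠ 0) :
    PeriodicSmooth fun p => F p / G p :=
  ⟨by simp only [div_eq_mul_inv]; exact hF.smooth.mul (hG.smooth.inv h),
    fun s t => by simp [hF.periodic s t, hG.periodic s t]⟩

theorem sum {ι : Type*} (S : Finset ι) {f : ι → ℝ × ℝ → ℂ}
    (h : ∀ i ∈ S, PeriodicSmooth (f i)) : PeriodicSmooth fun p => ∑ i ∈ S, f i p :=
  ⟨ContDiff.sum fun i hi => (h i hi).smooth,
    fun s t => Finset.sum_congr rfl fun i hi => (h i hi).periodic s t⟩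

theorem re (hF : PeriodicSmooth F) : PeriodicSmooth fun p => (((F p).re : ℝ) : ℂ) :=
  ⟨Complex.ofRealCLM.contDiff.comp (Complex.reCLM.contDiff.comp hF.smooth),
    fun s t => by simp [hF.periodic s t]⟩

theorem im (hF : PeriodicSmooth F) : PeriodicSmooth fun p => (((F p).im : ℝ) : ℂ) :=
  ⟨Complex.ofRealCLM.contDiff.comp (Complex.imCLM.contDiff.comp hF.smooth),
    fun s t => by simp [hF.periodic s t]⟩

theorem log_norm (hF : PeriodicSmooth F) (h : ∀ p, F p ≠ 0) :
    PeriodicSmooth fun p => ((Real.log ‖F p‖ : ℝ) : ℂ) :=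
  ⟨Complex.ofRealCLM.contDiff.comp
    ((hF.smooth.norm ℝ h).log fun p => norm_ne_zero_iff.2 (h p)),
    fun s t => by simp [hF.periodic s t]⟩

theorem of_parameter {a : ℝ → ℂ} (ha : ContDiff ℝ ∞ a) : PeriodicSmooth fun p => a p.2 :=
  ⟨ha.comp contDiff_snd, fun _ _ => rfl⟩

theorem of_translate {a : ℝ → ℂ} (ha : ContDiff ℝ ∞ a) (hp : Function.Periodic a (2 * π)) :
    PeriodicSmooth fun p => a (p.2 + p.1) :=
  ⟨ha.comp (contDiff_snd.add contDiff_fst), fun s t => by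
    simpa [add_assoc] using hp (t + s)⟩

theorem of_section {a : ℝ → ℂ} (ha : ContDiff ℝ ∞ a) (hp : Function.Periodic a (2 * π)) :
    PeriodicSmooth fun p => a p.1 :=
  ⟨ha.comp contDiff_fst, fun s _ => hp s⟩

/-- Periodicity in `s` reduces the claim to a compact square. No periodicity in `t` is required, as
`t` stays in one period. -/
theorem exists_bound (hF : PeriodicSmooth F) :
    ∃ K, ∀ t ∈ Set.Icc (0 : ℝ) (2 * π), ∀ s, ‖F (s, t)‖ ≤ K := by
  obtain ⟨K, hK⟩ := ((isCompact_Icc (a := (0 : ℝ)) (b := 2 * π)).prod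
    (isCompact_Icc (a := (0 : ℝ)) (b := 2 * π))).exists_bound_of_continuousOn
      hF.smooth.continuous.continuousOn
  refine ⟨K, fun t ht s => ?_⟩
  obtain ⟨y, hy, hys⟩ := (hF.section_periodic t).exists_mem_Ico₀ (by positivity) s
  have : F (s, t) = F (y, t) := hys
  rw [this]
  exact hK _ ⟨⟨hy.1, hy.2.le⟩, ht⟩

theorem exists_bound_iteratedDeriv (j : ℕ) : ∀ {F : ℝ × ℝ → ℂ}, PeriodicSmooth F →
    ∃ K, ∀ t ∈ Set.Icc (0 : ℝ) (2 * π), ∀ s, ‖iteratedDeriv j (fun s => F (s, t)) s‖ ≤ K := by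
  induction j with
  | zero => intro F hF; simpa using hF.exists_bound
  | succ j ih =>
    intro F hF
    simpa only [iteratedDeriv_succ'] using ih hF.deriv_fst

theorem fourierDecay (hF : PeriodicSmooth F) {q : ℕ} (hq : 2 ≤ q) :
    ∃ A, ∀ t ∈ Set.Icc (0 : ℝ) (2 * π), FourierDecay q A fun s => F (s, t) := by
  obtain ⟨K, hK⟩ := hF.exists_bound
  obtain ⟨K', hK'⟩ := hF.exists_bound_iteratedDeriv q
  exact ⟨max K K' * 2 ^ q, fun t ht => fourierDecay_of_contDiff (hF.section_contDiff t)
    (hF.section_periodic t) hq (fun s => (hK t ht s).trans (le_max_left _ _))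
    fun s => (hK' t ht s).trans (le_max_right _ _)⟩

end PeriodicSmooth

end HDI

namespace HDI

open Filter Topology

/-! ### The logarithmic singularity -/

/-- The Taylor coefficients of `(1 - w) ^ n * log (1 - w)` at the origin. -/
noncomputable def logCoeff : ℕ → ℕ → ℝ
  -- At `k = 0` division by zero gives `0`, the correct constant term of `log (1 - w)`.
  | 0, k => -(1 / k)
  | n + 1, 0 => logCoeff n 0
  | n + 1, k + 1 => logCoeff n (k + 1) - logCoeff n k

theorem hasSum_logCoeff {w : ℂ} (hw : ‖w‖ < 1) (n : ℕ) :
    HasSum (fun k => (logCoeff n k : ℂ) * w ^ k) ((1 - w) ^ n * Complex.log (1 - w)) := by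
  induction n with
  | zero =>
    have := (Complex.hasSum_taylorSeries_neg_log hw).neg
    rw [neg_neg] at this
    rw [pow_zero, one_mul]
    refine this.congr_terms fun k => ?_
    simp only [logCoeff]; push_cast; ring
  | succ n ih =>
    have h1 : HasSum (fun k => (logCoeff n (k + 1) : ℂ) * w ^ (k + 1))
        ((1 - w) ^ n * Complex.log (1 - w) - logCoeff n 0) := by
      have := (hasSum_nat_add_iff' (f := fun k => (logCoeff n k : ℂ) * w ^ k) 1).2 ih
      simpa using this
    have h2 := h1.sub (ih.mul_left w)
    have h3 : HasSum (fun k => (logCoeff (n + 1) (k + 1) : ℂ) * w ^ (k + 1))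
        ((1 - w) ^ (n + 1) * Complex.log (1 - w) - logCoeff (n + 1) 0) := by
      have e : (1 - w) ^ (n + 1) * Complex.log (1 - w) - logCoeff (n + 1) 0 =
          (1 - w) ^ n * Complex.log (1 - w) - logCoeff n 0
            - w * ((1 - w) ^ n * Complex.log (1 - w)) := by
        simp only [logCoeff]; ring
      rw [e]
      refine h2.congr_terms fun k => ?_
      simp only [logCoeff]; push_cast; ring
    have := (hasSum_nat_add_iff' (f := fun k => (logCoeff (n + 1) k : ℂ) * w ^ k) 1).1
      (by simpa using h3)
    exact this

/-- Multiplication by `1 - w` takes a backward difference of the coefficients, and iterated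
differences of `1 / k` are reciprocals of falling factorials. Each factor `1 - w` thus gains one
power of decay. -/
theorem logCoeff_eq (n : ℕ) : ∀ k, n < k →
    logCoeff n k = -(-1) ^ n * n.factorial / (k.descFactorial (n + 1) : ℝ) := by
  induction n with
  | zero => intro k _; simp [logCoeff]; ring
  | succ n ih =>
    intro k hk
    obtain ⟨k, rfl⟩ : ∃ j, k = j + 1 := ⟨k - 1, by omega⟩
    rw [logCoeff, ih (k + 1) (by omega), ih k (by omega)]
    have e1 : ((k + 1).descFactorial (n + 1) : ℝ) = (k + 1) * k.descFactorial n := by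
      rw [Nat.succ_descFactorial_succ]; push_cast; ring
    have e2 : (k.descFactorial (n + 1) : ℝ) = (k - n) * k.descFactorial n := by
      rw [Nat.descFactorial_succ, Nat.cast_mul, Nat.cast_sub (by omega)]
    have e3 : ((k + 1).descFactorial (n + 1 + 1) : ℝ) =
        (k + 1) * ((k - n) * k.descFactorial n) := by
      rw [Nat.succ_descFactorial_succ, Nat.cast_mul, e2]; push_cast; ring
    have hd : (k.descFactorial n : ℝ) ≠ 0 := by
      have := (Nat.descFactorial_pos (n := k) (k := n)).2 (by omega)
      positivity
    have hkn : (k : ℝ) - n ≠ 0 := by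
      have : (n : ℝ) < k := by exact_mod_cast (by omega : n < k)
      exact (sub_pos.2 this).ne'
    have hk1 : (k : ℝ) + 1 ≠ 0 := by positivity
    rw [e1, e2, e3, Nat.factorial_succ]
    push_cast
    field_simp
    ring

theorem abs_logCoeff_le (n : ℕ) :
    ∃ D, ∀ k : ℕ, |logCoeff n k| ≤ D * (1 / (1 + (k : ℝ)) ^ (n + 1)) := by
  -- `S` absorbs the finitely many `k ≤ n`, where the closed formula is not available.
  let S := ∑ k ∈ Finset.range (n + 1), |logCoeff n k| * (1 + (k : ℝ)) ^ (n + 1)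
  refine ⟨S + n.factorial * ((n : ℝ) + 2) ^ (n + 1), fun k => ?_⟩
  have hS : 0 ≤ S := Finset.sum_nonneg fun _ _ => by positivity
  rw [mul_one_div, le_div_iff₀ (by positivity)]
  rcases lt_or_ge n k with h | h
  · have hpos : (0 : ℝ) < k.descFactorial (n + 1) := by
      exact_mod_cast (Nat.descFactorial_pos (n := k) (k := n + 1)).2 h
    have h1 : ((k - n : ℕ) : ℝ) ^ (n + 1) ≤ k.descFactorial (n + 1) := by
      have := Nat.pow_sub_le_descFactorial k (n + 1)
      have e : k + 1 - (n + 1) = k - n := by omega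
      rw [e] at this
      exact_mod_cast this
    have h2 : 1 + (k : ℝ) ≤ (n + 2) * ((k - n : ℕ) : ℝ) := by
      obtain ⟨j, rfl⟩ : ∃ j, k = n + 1 + j := ⟨k - (n + 1), by omega⟩
      have : n + 1 + j - n = 1 + j := by omega
      rw [this]; push_cast
      nlinarith [mul_nonneg (Nat.cast_nonneg (α := ℝ) n) (Nat.cast_nonneg (α := ℝ) j),
        Nat.cast_nonneg (α := ℝ) j]
    have h3 : (1 + (k : ℝ)) ^ (n + 1) ≤ (n + 2) ^ (n + 1) * k.descFactorial (n + 1) := by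
      calc (1 + (k : ℝ)) ^ (n + 1) ≤ ((n + 2) * ((k - n : ℕ) : ℝ)) ^ (n + 1) := by gcongr
        _ = (n + 2) ^ (n + 1) * ((k - n : ℕ) : ℝ) ^ (n + 1) := mul_pow _ _ _
        _ ≤ _ := by gcongr
    rw [logCoeff_eq n k h, abs_div, abs_mul, abs_neg, abs_pow, abs_neg, abs_one, one_pow, one_mul,
      Nat.abs_cast, Nat.abs_cast, div_mul_eq_mul_div, div_le_iff₀ hpos]
    calc (n.factorial : ℝ) * (1 + (k : ℝ)) ^ (n + 1)
        ≤ n.factorial * ((n + 2) ^ (n + 1) * k.descFactorial (n + 1)) := by gcongr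
      _ = (0 + n.factorial * ((n : ℝ) + 2) ^ (n + 1)) * k.descFactorial (n + 1) := by ring
      _ ≤ _ := by gcongr
  · have : |logCoeff n k| * (1 + (k : ℝ)) ^ (n + 1) ≤ S :=
      Finset.single_le_sum (f := fun k => |logCoeff n k| * (1 + (k : ℝ)) ^ (n + 1))
        (fun _ _ => by positivity) (Finset.mem_range.2 (by omega))
    have h0 : (0 : ℝ) ≤ n.factorial * ((n : ℝ) + 2) ^ (n + 1) := by positivity
    linarith

theorem summable_abs_logCoeff {n : ℕ} (hn : 1 ≤ n) : Summable fun k => |logCoeff n k| := by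
  obtain ⟨D, hD⟩ := abs_logCoeff_le n
  refine Summable.of_nonneg_of_le (fun _ => abs_nonneg _) hD (Summable.mul_left D ?_)
  have := (summable_nat_add_iff 1).2
    (Real.summable_one_div_nat_pow.2 (show 1 < n + 1 by omega))
  refine this.congr fun n => ?_
  push_cast; ring

/-- Along a radius, `(1 - w) ^ n * log (1 - w)` is continuous up to the unit circle. -/
theorem tendsto_radial_log {n : ℕ} (hn : 1 ≤ n) {w : ℂ} (hw : ‖w‖ = 1) :
    Tendsto (fun r : ℝ => (1 - r * w) ^ n * Complex.log (1 - r * w)) (𝓝[<] 1)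
      (𝓝 ((1 - w) ^ n * Complex.log (1 - w))) := by
  have hlin : Continuous fun r : ℝ => 1 - (r : ℂ) * w := by fun_prop
  -- At `w = 1` one factor `1 - r` tames the logarithm, which is where `1 ≤ n` enters. Elsewhere `1
  -- - w` has positive real part, away from the branch cut.
  rcases eq_or_ne w 1 with rfl | h1
  · obtain ⟨n, rfl⟩ : ∃ j, n = j + 1 := ⟨n - 1, by omega⟩
    have hc : Continuous fun r : ℝ => (1 - r) ^ n * ((1 - r) * Real.log (1 - r)) :=
      ((continuous_const.sub continuous_id).pow n).mul
        (Real.continuous_mul_log.comp (continuous_const.sub continuous_id))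
    have h2 := (Complex.continuous_ofReal.comp hc).tendsto 1 |>.mono_left
      (nhdsWithin_le_nhds (s := Set.Iio 1))
    have h3 : (1 - 1 : ℂ) ^ (n + 1) * Complex.log (1 - 1) =
        (Complex.ofReal ∘ fun r : ℝ => (1 - r) ^ n * ((1 - r) * Real.log (1 - r))) 1 := by simp
    rw [h3]
    refine h2.congr' ?_
    filter_upwards [self_mem_nhdsWithin] with r hr
    have : (0 : ℝ) ≤ 1 - r := by simpa using (le_of_lt hr)
    have e : Complex.log (1 - (r : ℂ) * 1) = ((Real.log (1 - r) : ℝ) : ℂ) := by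
      rw [Complex.ofReal_log this]; simp
    rw [e]
    simp only [Function.comp]; push_cast; ring
  · have hre : 0 < (1 - w).re := by
      have h2 : w.re < 1 := by
        refine lt_of_le_of_ne (hw ▸ Complex.re_le_norm w) fun h3 => h1 ?_
        have h4 : w.re * w.re + w.im * w.im = 1 := by
          rw [← Complex.normSq_apply, Complex.normSq_eq_norm_sq, hw]; norm_num
        rw [h3] at h4
        have h5 : w.im = 0 := by nlinarith
        exact Complex.ext (by simp [h3]) (by simp [h5])
      simpa using h2
    have hlog : ContinuousAt Complex.log (1 - (1 : ℝ) * w) := by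
      refine continuousAt_clog (Or.inl ?_)
      simpa using hre
    have hcl : ContinuousAt (fun r : ℝ => Complex.log (1 - (r : ℂ) * w)) 1 :=
      ContinuousAt.comp (f := fun r : ℝ => 1 - (r : ℂ) * w) (x := (1 : ℝ)) hlog
        hlin.continuousAt
    have := ((hlin.pow n).continuousAt (x := (1 : ℝ))).mul hcl
    have h6 := this.tendsto.mono_left (nhdsWithin_le_nhds (s := Set.Iio (1 : ℝ)))
    have e : (1 - w) ^ n * Complex.log (1 - w) =
        (1 - ((1 : ℝ) : ℂ) * w) ^ n * Complex.log (1 - ((1 : ℝ) : ℂ) * w) := by simp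
    rw [e]
    exact h6

/-- The coefficients are absolutely summable for `n ≥ 1`, so dominated convergence along the radius
carries the expansion from the open disc to the circle. -/
theorem hasSum_logCoeff_circle {n : ℕ} (hn : 1 ≤ n) {w : ℂ} (hw : ‖w‖ = 1) :
    HasSum (fun k => (logCoeff n k : ℂ) * w ^ k) ((1 - w) ^ n * Complex.log (1 - w)) := by
  have hs := summable_abs_logCoeff hn
  have hsum : Summable fun k => (logCoeff n k : ℂ) * w ^ k := by
    refine Summable.of_norm (hs.congr fun k => ?_)
    rw [norm_mul, norm_pow, hw, one_pow, mul_one, Complex.norm_real, Real.norm_eq_abs]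
  have hlim : Tendsto (fun r : ℝ => ∑' k, (logCoeff n k : ℂ) * (r * w) ^ k) (𝓝[<] 1)
      (𝓝 (∑' k, (logCoeff n k : ℂ) * w ^ k)) := by
    refine tendsto_tsum_of_dominated_convergence hs (fun k => ?_) ?_
    · have : Continuous fun r : ℝ => (logCoeff n k : ℂ) * (r * w) ^ k := by fun_prop
      simpa using (this.tendsto 1).mono_left (nhdsWithin_le_nhds (s := Set.Iio (1 : ℝ)))
    · filter_upwards [Ioo_mem_nhdsLT (show (0 : ℝ) < 1 by norm_num)] with r hr k
      rw [norm_mul, norm_pow, norm_mul, hw, mul_one, Complex.norm_real, Complex.norm_real,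
        Real.norm_eq_abs, Real.norm_eq_abs, abs_of_pos hr.1]
      exact mul_le_of_le_one_right (abs_nonneg _) (pow_le_one₀ hr.1.le hr.2.le)
  have heq : Tendsto (fun r : ℝ => ∑' k, (logCoeff n k : ℂ) * (r * w) ^ k) (𝓝[<] 1)
      (𝓝 ((1 - w) ^ n * Complex.log (1 - w))) := by
    refine (tendsto_radial_log hn hw).congr' ?_
    filter_upwards [Ioo_mem_nhdsLT (show (0 : ℝ) < 1 by norm_num)] with r hr
    refine (hasSum_logCoeff ?_ n).tsum_eq.symm
    rw [norm_mul, hw, mul_one, Complex.norm_real, Real.norm_eq_abs, abs_of_pos hr.1]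
    exact hr.2
  rw [← tendsto_nhds_unique hlim heq]
  exact hsum.hasSum

theorem fourierDecay_pow_mul_log {n : ℕ} (hn : 1 ≤ n) :
    ∃ D, FourierDecay (n + 1) D fun s =>
      (1 - character 1 s) ^ n * Complex.log (1 - character 1 s) := by
  obtain ⟨D, hD⟩ := abs_logCoeff_le n
  have hD0 : 0 ≤ D := by simpa using (abs_nonneg _).trans (hD 0)
  have hinj : Function.Injective (fun k : ℕ => (k : ℤ)) := Nat.cast_injective
  refine ⟨D, fun j : ℤ => if 0 ≤ j then (logCoeff n j.toNat : ℂ) else 0, fun j => ?_, fun s => ?_⟩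
  · beta_reduce
    split_ifs with h
    · obtain ⟨k, rfl⟩ := Int.eq_ofNat_of_zero_le h
      simpa using hD k
    · rw [norm_zero]; positivity
  · rw [← hinj.hasSum_iff]
    · refine (hasSum_logCoeff_circle hn (norm_character 1 s)).congr_terms fun k => ?_
      simp [character_natCast]
    · intro j hj
      have : ¬ 0 ≤ j := fun h => hj ⟨j.toNat, by simp [h]⟩
      simp [this]

/-- The model singularity `log |e^{is} - 1| (e^{is} - 1)^n` has Fourier coefficients of order
`|k|^{-n-1}`. -/
theorem fourierDecay_log_norm {n : ℕ} (hn : 1 ≤ n) :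
    ∃ D, FourierDecay (n + 1) D fun s =>
      ((Real.log ‖character 1 s - 1‖ : ℝ) : ℂ) * (character 1 s - 1) ^ n := by
  obtain ⟨D, hD⟩ := fourierDecay_pow_mul_log hn
  have h := ((hD.add ((hD.conj.mul_character n).const_mul ((-1) ^ n))).const_mul ((-1) ^ n / 2))
  have hfun : (fun s => ((Real.log ‖character 1 s - 1‖ : ℝ) : ℂ) * (character 1 s - 1) ^ n) =
      fun s => (-1) ^ n / 2 * ((1 - character 1 s) ^ n * Complex.log (1 - character 1 s) +
        (-1) ^ n * ((starRingEnd ℂ) ((1 - character 1 s) ^ n * Complex.log (1 - character 1 s))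
          * character n s)) := by
    funext s
    set w := character 1 s with hw
    have hww : w * (starRingEnd ℂ) w = 1 := by
      rw [Complex.mul_conj, Complex.normSq_eq_norm_sq, hw, norm_character]; norm_num
    -- `log |w - 1|` is the average of `log (1 - w)` and its conjugate. On the circle `1 - w = -w (1
    -- - conj w)`, so the conjugate half is `w^n` times the conjugate of the function already
    -- expanded.
    have hflip : (1 - w) ^ n = (-1) ^ n * w ^ n * (1 - (starRingEnd ℂ) w) ^ n := by
      rw [← mul_pow, ← mul_pow]; congr 1; linear_combination -hww
    have hre : ((Real.log ‖w - 1‖ : ℝ) : ℂ) =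
        (Complex.log (1 - w) + (starRingEnd ℂ) (Complex.log (1 - w))) / 2 := by
      rw [Complex.add_conj, Complex.log_re, norm_sub_rev]; push_cast; ring
    have hneg : (w - 1) ^ n = (-1) ^ n * (1 - w) ^ n := by
      rw [← mul_pow]; congr 1; ring
    rw [hre, hneg, character_natCast, ← hw, map_mul, map_pow, map_sub, map_one]
    linear_combination ((-1) ^ n / 2 * (starRingEnd ℂ) (Complex.log (1 - w))) * hflip
  exact ⟨_, hfun ▸ h⟩

end HDI

namespace HDI

open Filter Topology MeasureTheory
open scoped ContDiff

/-! ### Division of smooth families by their zeros -/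

/-- Differentiation under the integral sign, by induction on the order. The target space is
quantified inside because the derivative takes values in a space of linear maps. -/
theorem contDiff_parametric_intervalIntegral_nat (n : ℕ) :
    ∀ {E : Type} [NormedAddCommGroup E] [NormedSpace ℝ E] [CompleteSpace E]
      {f : (ℝ × ℝ) × ℝ → E}, ContDiff ℝ n f →
      ContDiff ℝ n fun x => ∫ u in (0 : ℝ)..1, f (x, u) := by
  induction n with
  | zero =>
    intro E _ _ _ f hf
    have hc : Continuous f := hf.continuous
    refine contDiff_zero.2 ?_
    exact intervalIntegral.continuous_parametric_intervalIntegral_of_continuous'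
      (f := fun x u => f (x, u)) hc 0 1
  | succ n ih =>
    intro E _ _ _ f hf
    have hf1 : ContDiff ℝ n (fderiv ℝ f) := hf.fderiv_right (by norm_cast)
    let g : (ℝ × ℝ) × ℝ → (ℝ × ℝ →L[ℝ] E) := fun p =>
      (fderiv ℝ f p).comp (ContinuousLinearMap.inl ℝ (ℝ × ℝ) ℝ)
    have hg : ContDiff ℝ n g := hf1.clm_comp contDiff_const
    have hdiff : Differentiable ℝ f := hf.differentiable (by simp)
    refine contDiff_succ_iff_hasFDerivAt.2
      ⟨fun x => ∫ u in (0 : ℝ)..1, g (x, u), ih hg, fun x => ?_⟩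
    obtain ⟨K, hK⟩ := ((isCompact_closedBall x 1).prod
      (isCompact_Icc (a := (0 : ℝ)) (b := 1))).exists_bound_of_continuousOn
        hg.continuous.continuousOn
    refine intervalIntegral.hasFDerivAt_integral_of_dominated_of_fderiv_le
      (F := fun x u => f (x, u)) (F' := fun x u => g (x, u)) (bound := fun _ => K)
      (Metric.closedBall_mem_nhds x one_pos)
      (Eventually.of_forall fun y => ?_) ?_ ?_ ?_ ?_ ?_
    · exact (hf.continuous.comp (by fun_prop : Continuous fun u : ℝ => (y, u))).aestronglyMeasurable
    · exact (hf.continuous.comp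
        (by fun_prop : Continuous fun u : ℝ => (x, u))).intervalIntegrable _ _
    · exact (hg.continuous.comp (by fun_prop : Continuous fun u : ℝ => (x, u))).aestronglyMeasurable
    · refine Eventually.of_forall fun u hu y hy => hK (y, u) ⟨hy, ?_⟩
      rw [Set.uIoc_of_le zero_le_one] at hu
      exact ⟨hu.1.le, hu.2⟩
    · exact intervalIntegrable_const
    · refine Eventually.of_forall fun u _ y _ => ?_
      exact (hdiff (y, u)).hasFDerivAt.comp y (hasFDerivAt_prodMk_left y u)

theorem contDiff_parametric_intervalIntegral {E : Type} [NormedAddCommGroup E] [NormedSpace ℝ E]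
    [CompleteSpace E] {f : (ℝ × ℝ) × ℝ → E} (hf : ContDiff ℝ ∞ f) :
    ContDiff ℝ ∞ fun x => ∫ u in (0 : ℝ)..1, f (x, u) :=
  contDiff_infty.2 fun n => contDiff_parametric_intervalIntegral_nat n
    (hf.of_le (by exact_mod_cast le_top))

/-- Hadamard's lemma with a parameter. -/
theorem exists_smooth_slope {F : ℝ × ℝ → ℂ} (hF : ContDiff ℝ ∞ F) (s₀ : ℝ) :
    ∃ K : ℝ × ℝ → ℂ, ContDiff ℝ ∞ K ∧ (∀ s t, F (s, t) - F (s₀, t) = (s - s₀ : ℝ) * K (s, t)) ∧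
      ∀ t, K (s₀, t) = deriv (fun s => F (s, t)) s₀ := by
  have hD := PeriodicSmooth.contDiff_deriv_fst hF
  let D : ℝ × ℝ → ℂ := fun p => deriv (fun s => F (s, p.2)) p.1
  -- The slope is the mean of `∂F/∂s` over the segment from `s₀` to `s`.
  let f : (ℝ × ℝ) × ℝ → ℂ := fun x => D (s₀ + x.2 * (x.1.1 - s₀), x.1.2)
  have hf : ContDiff ℝ ∞ f := by
    refine ContDiff.comp (g := D) hD ?_
    fun_prop
  refine ⟨fun x => ∫ u in (0 : ℝ)..1, f (x, u), contDiff_parametric_intervalIntegral hf,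
    fun s t => ?_, fun t => ?_⟩
  · have hd : ∀ u : ℝ, HasDerivAt (fun u : ℝ => F (s₀ + u * (s - s₀), t))
        ((s - s₀ : ℝ) * f ((s, t), u)) u := by
      intro u
      have h1 : HasDerivAt (fun s => F (s, t)) (D (s₀ + u * (s - s₀), t)) (s₀ + u * (s - s₀)) := by
        have : ContDiff ℝ ∞ fun s => F (s, t) := hF.comp (contDiff_id.prodMk contDiff_const)
        exact (this.differentiable (by simp) _).hasDerivAt
      have h2 : HasDerivAt (fun u : ℝ => s₀ + u * (s - s₀)) (s - s₀) u := by
        simpa using ((hasDerivAt_id u).mul_const (s - s₀)).const_add s₀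
      have := h1.scomp u h2
      rwa [Complex.real_smul] at this
    have hfc : Continuous fun u : ℝ => ((s - s₀ : ℝ) : ℂ) * f ((s, t), u) :=
      continuous_const.mul (hf.continuous.comp (by fun_prop : Continuous fun u : ℝ => ((s, t), u)))
    have := intervalIntegral.integral_eq_sub_of_hasDerivAt (a := 0) (b := 1)
      (fun u _ => hd u) (hfc.intervalIntegrable _ _)
    rw [intervalIntegral.integral_const_mul] at this
    simp only [one_mul, zero_mul, add_zero, add_sub_cancel] at this
    exact this.symm
  · simp [f, D]

theorem contDiff_character (n : ℤ) : ContDiff ℝ ∞ (character n) := by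
  have h : ContDiff ℝ ∞ fun τ : ℝ => (n : ℂ) * (τ : ℂ) * Complex.I :=
    (contDiff_const.mul Complex.ofRealCLM.contDiff).mul contDiff_const
  exact h.cexp

theorem character_periodic (n : ℤ) : Function.Periodic (character n) (2 * π) := fun s => by
  rw [character_add_right, character_two_pi, mul_one]

theorem character_one_eq_one_iff {s : ℝ} : character 1 s = 1 ↔ ∃ k : ℤ, s = k * (2 * π) := by
  rw [character, Complex.exp_eq_one_iff]
  refine exists_congr fun k => ?_
  constructor
  · intro h
    have h' : (s : ℂ) = ((k * (2 * π) : ℝ) : ℂ) := by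
      have hI := Complex.I_ne_zero
      push_cast at h ⊢
      apply mul_right_cancel₀ hI
      linear_combination h
    exact_mod_cast h'
  · rintro rfl
    push_cast; ring

/-! ### Divisibility of periodic families by powers of `e^{is} - 1`. -/

namespace PeriodicSmooth

variable {F : ℝ × ℝ → ℂ}

theorem eq_at_zero (hF : PeriodicSmooth F) {s : ℝ} (hs : character 1 s = 1) (t : ℝ) :
    F (s, t) = F (0, t) := by
  obtain ⟨k, rfl⟩ := character_one_eq_one_iff.1 hs
  simpa using (hF.section_periodic t).int_mul k 0

theorem character_one_sub_one : PeriodicSmooth fun p => character 1 p.1 - 1 :=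
  (of_section (contDiff_character 1) (character_periodic 1)).sub (const 1)

/-- A family vanishing at `s = 0` is divisible by `e^{is} - 1`. -/
theorem exists_factor (hF : PeriodicSmooth F) (h0 : ∀ t, F (0, t) = 0) :
    ∃ G, PeriodicSmooth G ∧ (∀ p, F p = (character 1 p.1 - 1) * G p) ∧
      ∀ t, G (0, t) = deriv (fun s => F (s, t)) 0 / Complex.I := by
  classical
  let G : ℝ × ℝ → ℂ := fun p => if character 1 p.1 = 1 then
    deriv (fun s => F (s, p.2)) p.1 / Complex.I else F p / (character 1 p.1 - 1)
  have hFG : ∀ p, F p = (character 1 p.1 - 1) * G p := by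
    rintro ⟨s, t⟩
    simp only [G]
    split_ifs with h
    · rw [hF.eq_at_zero h, h0, h, sub_self, zero_mul]
    · rw [mul_div_cancel₀ _ (sub_ne_zero.2 h)]
  refine ⟨G, ⟨contDiff_iff_contDiffAt.2 ?_, fun s t => ?_⟩, hFG, fun t => ?_⟩
  · rintro ⟨s₀, t₀⟩
    by_cases h : character 1 s₀ = 1
    -- Near a zero `s₀` both `F` and `e^{is} - 1` are `s - s₀` times smooth slopes `K` and `E`. As
    -- `E = i` at `s₀`, the quotient is locally the smooth function `K / E`.
    · obtain ⟨K, hKs, hK, hK0⟩ := exists_smooth_slope hF.smooth s₀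
      obtain ⟨E, hEs, hE, hE0⟩ := exists_smooth_slope
        (of_section (contDiff_character 1) (character_periodic 1)).smooth s₀
      have hE0' : ∀ t, E (s₀, t) = Complex.I := by
        intro t
        rw [hE0, (hasDerivAt_character 1 s₀).deriv, h]; simp
      have hne : E (s₀, t₀) ≠ 0 := by rw [hE0']; exact Complex.I_ne_zero
      have hev : ∀ᶠ p in 𝓝 (s₀, t₀), E p ≠ 0 :=
        hEs.continuous.continuousAt.eventually_ne hne
      have hcd : ContDiffAt ℝ ∞ (fun p => K p * (E p)⁻¹) (s₀, t₀) :=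
        hKs.contDiffAt.mul (hEs.contDiffAt.inv hne)
      refine hcd.congr_of_eventuallyEq ?_
      filter_upwards [hev] with p hp
      obtain ⟨s, t⟩ := p
      have h1 := hE s t
      have h2 := hK s t
      simp only [h] at h1
      rw [hF.eq_at_zero h, h0, sub_zero] at h2
      simp only [G]
      split_ifs with h'
      · rw [h', sub_self] at h1
        have h3 : s = s₀ := by
          rcases mul_eq_zero.1 h1.symm with h4 | h4
          · exact sub_eq_zero.1 (by exact_mod_cast h4)
          · exact absurd h4 hp
        rw [h3, hK0, hE0', div_eq_mul_inv]
      · have h3 : ((s - s₀ : ℝ) : ℂ) ≠ 0 := by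
          intro h4
          rw [h4, zero_mul] at h1
          exact h' (sub_eq_zero.1 h1)
        rw [h1, h2]
        field_simp
    · have hc : Continuous fun p : ℝ × ℝ => character 1 p.1 :=
        (continuous_character 1).comp continuous_fst
      have hev : ∀ᶠ p : ℝ × ℝ in 𝓝 (s₀, t₀), character 1 p.1 ≠ 1 :=
        hc.continuousAt.eventually_ne h
      have hcd : ContDiffAt ℝ ∞ (fun p => F p * (character 1 p.1 - 1)⁻¹) (s₀, t₀) :=
        hF.smooth.contDiffAt.mul
          (character_one_sub_one.smooth.contDiffAt.inv (sub_ne_zero.2 h))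
      refine hcd.congr_of_eventuallyEq ?_
      filter_upwards [hev] with p hp
      simp only [G, if_neg hp, div_eq_mul_inv]
  · simp only [G, character_periodic 1 s, hF.periodic s t]
    rw [periodic_deriv (hF.section_periodic t) s]
  · simp [G, character_at_zero]

theorem isBigO_character_sub_one :
    (fun s : ℝ => s) =O[𝓝 0] fun s : ℝ => character 1 s - 1 := by
  have h := ((hasDerivAt_character 1 0).isTheta_sub (by simp [character_at_zero])).isBigO_symm
  simpa [character_at_zero, Function.comp_def] using h

/-- A family vanishing at `s = 0` to order `n` is divisible by `(e^{is} - 1)^n`. -/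
theorem exists_pow_factor (n : ℕ) : ∀ {F : ℝ × ℝ → ℂ}, PeriodicSmooth F →
    (∀ t, (fun s => F (s, t)) =O[𝓝[≠] 0] fun s : ℝ => s ^ n) →
    ∃ G, PeriodicSmooth G ∧ ∀ p, F p = (character 1 p.1 - 1) ^ n * G p := by
  induction n with
  | zero => intro F hF _; exact ⟨F, hF, by simp⟩
  | succ n ih =>
    intro F hF hO
    have h0 : ∀ t, F (0, t) = 0 := by
      intro t
      have h1 : Tendsto (fun s => F (s, t)) (𝓝[≠] 0) (𝓝 0) := by
        refine (hO t).trans_tendsto ?_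
        have : Continuous fun s : ℝ => s ^ (n + 1) := by fun_prop
        simpa using (this.tendsto 0).mono_left (nhdsWithin_le_nhds (s := {0}ᶜ))
      have h2 : Tendsto (fun s => F (s, t)) (𝓝[≠] 0) (𝓝 (F (0, t))) :=
        ((hF.section_contDiff t).continuous.tendsto 0).mono_left nhdsWithin_le_nhds
      exact tendsto_nhds_unique h2 h1
    obtain ⟨G, hG, hFG, -⟩ := hF.exists_factor h0
    obtain ⟨H, hH, hGH⟩ := ih hG fun t => by
      -- Since `s = O(e^{is} - 1)`, the bound on `F` passes to `s G`. The punctured neighbourhood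
      -- then permits division by `s`.
      have h1 : (fun s : ℝ => (s : ℂ) * G (s, t)) =O[𝓝[≠] 0] fun s : ℝ => s ^ (n + 1) := by
        refine Asymptotics.IsBigO.trans ?_ (hO t)
        have h2 : (fun s : ℝ => (s : ℂ)) =O[𝓝[≠] 0] fun s : ℝ => character 1 s - 1 := by
          refine (Asymptotics.IsBigO.of_norm_left ?_).mono nhdsWithin_le_nhds
          simpa using isBigO_character_sub_one.norm_left
        simpa only [hFG] using h2.mul (Asymptotics.isBigO_refl (fun s => G (s, t)) _)
      have hinv : (fun s : ℝ => ((s⁻¹ : ℝ) : ℂ)) =O[𝓝[≠] 0] fun s : ℝ => s⁻¹ :=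
        Asymptotics.IsBigO.of_norm_left (by
          simpa using (Asymptotics.isBigO_refl (fun s : ℝ => s⁻¹) (𝓝[≠] 0)).norm_left)
      have h3 := h1.mul hinv
      refine h3.congr' ?_ ?_
      · filter_upwards [self_mem_nhdsWithin] with s hs
        have : (s : ℂ) ≠ 0 := by exact_mod_cast hs
        push_cast; field_simp
      · filter_upwards [self_mem_nhdsWithin] with s hs
        have : s ≠ 0 := hs
        rw [pow_succ, mul_assoc, mul_inv_cancel₀ this, mul_one]
    exact ⟨H, hH, fun p => by rw [hFG p, hGH p]; ring⟩

end PeriodicSmooth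

end HDI

namespace HDI

open Filter Topology
open scoped ContDiff

/-! ### Bell polynomials and the interpolation conditions -/

theorem partialBell_eq_zero (x : ℕ → ℂ) : ∀ {j m : ℕ}, m < j → partialBell x j m = 0
  | 0, _, h => absurd h (Nat.not_lt_zero _)
  | _ + 1, 0, _ => by rw [partialBell]
  | j + 1, m + 1, h => by
    rw [partialBell]
    refine Finset.sum_eq_zero fun i _ => ?_
    rw [partialBell_eq_zero x (show m - i < j by omega), mul_zero]

theorem partialBell_self (x : ℕ → ℂ) : ∀ j : ℕ, partialBell x j j = x 1 ^ j
  | 0 => by simp [partialBell]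
  | j + 1 => by
    rw [partialBell, Finset.sum_eq_single 0]
    · simp [partialBell_self x j, pow_succ']
    · intro i hi h0
      have := Finset.mem_range.1 hi
      rw [partialBell_eq_zero x (show j - i < j by omega), mul_zero]
    · simp

/-- The derivatives of the divided powers of `ζ - ζ t` at `t` are partial Bell polynomials. -/
theorem iteratedDeriv_pow_div_factorial {ζ : ℝ → ℂ} (hζ : ContDiff ℝ ∞ ζ) (t : ℝ) :
    ∀ j m : ℕ, iteratedDeriv m (fun τ => (ζ τ - ζ t) ^ j / (j.factorial : ℂ)) t =
      partialBell (fun n => iteratedDeriv n ζ t) j m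
  | 0, m => by
    simp [iteratedDeriv_const, partialBell]
  | j + 1, 0 => by simp [partialBell]
  | j + 1, m + 1 => by
    -- A divided power differentiates to `ζ'` times the preceding one; Leibniz's rule on this
    -- product is exactly the recurrence of `partialBell`.
    have hd : deriv (fun τ => (ζ τ - ζ t) ^ (j + 1) / ((j + 1).factorial : ℂ)) =
        fun τ => deriv ζ τ * ((ζ τ - ζ t) ^ j / (j.factorial : ℂ)) := by
      funext τ
      have h1 : HasDerivAt ζ (deriv ζ τ) τ := (hζ.differentiable (by simp) τ).hasDerivAt
      have h2 := (((h1.sub_const (ζ t)).pow (j + 1)).div_const ((j + 1).factorial : ℂ)).deriv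
      have h3 : (j.factorial : ℂ) ≠ 0 := by exact_mod_cast j.factorial_ne_zero
      have h4 : ((j : ℂ) + 1) ≠ 0 := by exact_mod_cast j.succ_ne_zero
      refine h2.trans ?_
      rw [Nat.factorial_succ]; push_cast
      field_simp
    have hc1 : ContDiff ℝ ∞ (deriv ζ) := (contDiff_infty_iff_deriv.1 hζ).2
    have hc2 : ContDiff ℝ ∞ fun τ => (ζ τ - ζ t) ^ j / (j.factorial : ℂ) :=
      ((hζ.sub contDiff_const).pow j).div_const _
    rw [iteratedDeriv_succ', hd, iteratedDeriv_fun_mul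
      (hc1.contDiffAt.of_le (by exact_mod_cast le_top))
      (hc2.contDiffAt.of_le (by exact_mod_cast le_top)), partialBell]
    refine Finset.sum_congr rfl fun i _ => ?_
    rw [iteratedDeriv_pow_div_factorial hζ t j (m - i), ← iteratedDeriv_succ']

theorem iteratedDeriv_ofReal (n : ℕ) : ∀ {f : ℝ → ℝ}, ContDiff ℝ ∞ f → ∀ t,
    iteratedDeriv n (fun s => (f s : ℂ)) t = ((iteratedDeriv n f t : ℝ) : ℂ) := by
  induction n with
  | zero => intro f _ t; simp
  | succ n ih =>
    intro f hf t
    have hd : deriv (fun s => (f s : ℂ)) = fun s => ((deriv f s : ℝ) : ℂ) := by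
      funext s
      exact ((hf.differentiable (by simp) s).hasDerivAt.ofReal_comp).deriv
    rw [iteratedDeriv_succ', hd, ih (contDiff_infty_iff_deriv.1 hf).2, iteratedDeriv_succ']

/-! ### Regularity of the curve and solvability of the coefficient system. -/

namespace IsAnalyticClosedCurve

variable {ζ : ℝ → ℂ}

theorem contDiff (hζ : IsAnalyticClosedCurve ζ) : ContDiff ℝ ∞ ζ := hζ.analytic.contDiff

theorem contDiff_deriv (hζ : IsAnalyticClosedCurve ζ) : ContDiff ℝ ∞ (deriv ζ) :=
  (contDiff_infty_iff_deriv.1 hζ.contDiff).2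

theorem hasDerivAt (hζ : IsAnalyticClosedCurve ζ) (τ : ℝ) : HasDerivAt ζ (deriv ζ τ) τ :=
  (hζ.contDiff.differentiable (by simp) τ).hasDerivAt

theorem norm_deriv_pos (hζ : IsAnalyticClosedCurve ζ) (τ : ℝ) : 0 < ‖deriv ζ τ‖ :=
  norm_pos_iff.2 (hζ.regular τ)

theorem analyticAt_norm_deriv (hζ : IsAnalyticClosedCurve ζ) (τ : ℝ) :
    AnalyticAt ℝ (fun s => ‖deriv ζ s‖) τ :=
  (((hζ.analytic.deriv τ (Set.mem_univ τ)).contDiffAt (n := ω)).norm ℝ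
    (hζ.regular τ)).analyticAt

theorem contDiff_norm_deriv (hζ : IsAnalyticClosedCurve ζ) :
    ContDiff ℝ ∞ fun s => ‖deriv ζ s‖ :=
  hζ.contDiff_deriv.norm ℝ hζ.regular

theorem contDiff_inv_norm_deriv (hζ : IsAnalyticClosedCurve ζ) :
    ContDiff ℝ ∞ fun s => 1 / ‖deriv ζ s‖ :=
  contDiff_const.div hζ.contDiff_norm_deriv fun s => (hζ.norm_deriv_pos s).ne'

theorem det_leibnizMatrix_ne_zero (hζ : IsAnalyticClosedCurve ζ) (M : ℕ) (t : ℝ) :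
    (leibnizMatrix ζ M t).det ≠ 0 := by
  rw [Matrix.det_of_isLowerTriangular]
  · refine Finset.prod_ne_zero_iff.2 fun i _ => ?_
    simpa [leibnizMatrix] using hζ.regular t
  · intro i k hik
    have : (i : ℕ) < k := hik
    simp only [leibnizMatrix, Matrix.of_apply, if_pos this]

theorem det_bellMatrix_ne_zero (hζ : IsAnalyticClosedCurve ζ) (M : ℕ) (t : ℝ) :
    (bellMatrix ζ M t).det ≠ 0 := by
  rw [Matrix.det_of_isLowerTriangular]
  · refine Finset.prod_ne_zero_iff.2 fun i _ => ?_
    simpa [bellMatrix, partialBell_self] using hζ.regular t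
  · intro i k hik
    have : (i : ℕ) < k := hik
    simp only [bellMatrix, Matrix.of_apply]
    exact partialBell_eq_zero _ (by omega)

/-- Both factors are lower triangular, with the nonzero diagonals `1 / |ζ'|` and `ζ' ^ (i + 1)`. -/
theorem det_mul_ne_zero (hζ : IsAnalyticClosedCurve ζ) (M : ℕ) (t : ℝ) :
    (leibnizMatrix ζ M t * bellMatrix ζ M t).det ≠ 0 := by
  rw [Matrix.det_mul]
  exact mul_ne_zero (hζ.det_leibnizMatrix_ne_zero M t) (hζ.det_bellMatrix_ne_zero M t)

/-- The linear system that defines the coefficients. -/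
theorem leibnizMatrix_mulVec_bellMatrix_mulVec_coeff (hζ : IsAnalyticClosedCurve ζ) (φ : ℝ → ℝ)
    (M : ℕ) (t : ℝ) :
    (leibnizMatrix ζ M t).mulVec ((bellMatrix ζ M t).mulVec (coeff ζ φ M t)) =
      fun i : Fin (M + 1) => Complex.I * ((iteratedDeriv i φ t : ℝ) : ℂ) := by
  have hu : IsUnit (leibnizMatrix ζ M t * bellMatrix ζ M t).det :=
    (hζ.det_mul_ne_zero M t).isUnit
  rw [Matrix.mulVec_mulVec, coeff, Matrix.mulVec_mulVec, Matrix.mul_nonsing_inv _ hu,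
    Matrix.one_mulVec]

end IsAnalyticClosedCurve

/-- The complex polynomial whose real part is the harmonic interpolant. -/
noncomputable def interpPoly (ζ : ℝ → ℂ) (φ : ℝ → ℝ) (M : ℕ) (t : ℝ) (z : ℂ) : ℂ :=
  ∑ k : Fin (M + 1), coeff ζ φ M t k / (((k : ℕ) + 1).factorial : ℂ) * (z - ζ t) ^ ((k : ℕ) + 1)

/-- The derivative of `interpPoly`. -/
noncomputable def interpDeriv (ζ : ℝ → ℂ) (φ : ℝ → ℝ) (M : ℕ) (t : ℝ) (z : ℂ) : ℂ :=
  ∑ k : Fin (M + 1), coeff ζ φ M t k / ((k : ℕ).factorial : ℂ) * (z - ζ t) ^ (k : ℕ)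

theorem hasDerivAt_interpPoly (ζ : ℝ → ℂ) (φ : ℝ → ℝ) (M : ℕ) (t : ℝ) (z : ℂ) :
    HasDerivAt (interpPoly ζ φ M t) (interpDeriv ζ φ M t z) z := by
  refine HasDerivAt.fun_sum fun k _ => ?_
  have h := ((((hasDerivAt_id z).sub_const (ζ t)).pow ((k : ℕ) + 1)).const_mul
    (coeff ζ φ M t k / (((k : ℕ) + 1).factorial : ℂ)))
  refine h.congr_deriv ?_
  have h3 : ((k : ℕ).factorial : ℂ) ≠ 0 := by exact_mod_cast (k : ℕ).factorial_ne_zero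
  have h4 : (((k : ℕ) : ℂ) + 1) ≠ 0 := by exact_mod_cast (k : ℕ).succ_ne_zero
  rw [Nat.factorial_succ]; push_cast
  simp only [id]
  field_simp

theorem interpPoly_self (ζ : ℝ → ℂ) (φ : ℝ → ℝ) (M : ℕ) (t : ℝ) :
    interpPoly ζ φ M t (ζ t) = 0 := by
  simp [interpPoly]

theorem traceP_eq (ζ : ℝ → ℂ) (φ : ℝ → ℝ) (M : ℕ) (τ t : ℝ) :
    traceP ζ φ M τ t = (interpPoly ζ φ M t (ζ τ)).re := rfl

theorem traceP_self (ζ : ℝ → ℂ) (φ : ℝ → ℝ) (M : ℕ) (t : ℝ) : traceP ζ φ M t t = 0 := by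
  rw [traceP_eq, interpPoly_self, Complex.zero_re]

theorem traceQ_eq (ζ : ℝ → ℂ) (φ : ℝ → ℝ) (M : ℕ) (τ t : ℝ) :
    traceQ ζ φ M τ t = (interpDeriv ζ φ M t (ζ τ) * normal ζ τ).re := by
  have h1 := (hasDerivAt_interpPoly ζ φ M t (ζ τ)).hasFDerivAt.restrictScalars ℝ
  have h2 := (Complex.reCLM.hasFDerivAt (x := interpPoly ζ φ M t (ζ τ))).comp (ζ τ) h1
  have h3 : fderiv ℝ (harmonicInterp ζ φ M t) (ζ τ) = _ := h2.fderiv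
  rw [traceQ, h3]
  simp [mul_comm]

theorem IsAnalyticClosedCurve.normal_mul_norm {ζ : ℝ → ℂ} (hζ : IsAnalyticClosedCurve ζ) (τ : ℝ) :
    normal ζ τ * ‖deriv ζ τ‖ = -Complex.I * deriv ζ τ := by
  have := (hζ.norm_deriv_pos τ).ne'
  apply Complex.ext <;> simp [normal] <;> field_simp

/-- The Cauchy-Riemann equations: as `n |ζ'| = -i ζ'`, the Neumann trace is the tangential
derivative of the conjugate function `Im f`. -/
theorem IsAnalyticClosedCurve.traceQ_mul_norm {ζ : ℝ → ℂ} (hζ : IsAnalyticClosedCurve ζ)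
    (φ : ℝ → ℝ) (M : ℕ) (τ t : ℝ) :
    traceQ ζ φ M τ t * ‖deriv ζ τ‖ = (interpDeriv ζ φ M t (ζ τ) * deriv ζ τ).im := by
  rw [traceQ_eq, ← Complex.re_mul_ofReal, mul_assoc, hζ.normal_mul_norm]
  simp; ring

theorem IsAnalyticClosedCurve.hasDerivAt_interpPoly_comp {ζ : ℝ → ℂ}
    (hζ : IsAnalyticClosedCurve ζ) (φ : ℝ → ℝ) (M : ℕ) (t τ : ℝ) :
    HasDerivAt (fun τ => interpPoly ζ φ M t (ζ τ))
      (interpDeriv ζ φ M t (ζ τ) * deriv ζ τ) τ :=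
  (hasDerivAt_interpPoly ζ φ M t (ζ τ)).comp τ (hζ.hasDerivAt τ)

/-- The function is the derivative of `f ∘ ζ`, a combination of divided powers of `ζ - ζ t`. The
extra derivative accounts for row `i` of `bellMatrix` holding order `i + 1`. -/
theorem IsAnalyticClosedCurve.iteratedDeriv_interpDeriv {ζ : ℝ → ℂ}
    (hζ : IsAnalyticClosedCurve ζ) (φ : ℝ → ℝ) (M : ℕ) (t : ℝ) (i : Fin (M + 1)) :
    iteratedDeriv i (fun τ => interpDeriv ζ φ M t (ζ τ) * deriv ζ τ) t =
      (bellMatrix ζ M t).mulVec (coeff ζ φ M t) i := by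
  have hd : deriv (fun τ => interpPoly ζ φ M t (ζ τ)) =
      fun τ => interpDeriv ζ φ M t (ζ τ) * deriv ζ τ :=
    funext fun τ => (hζ.hasDerivAt_interpPoly_comp φ M t τ).deriv
  have he : (fun τ => interpPoly ζ φ M t (ζ τ)) = fun τ => ∑ k : Fin (M + 1),
      coeff ζ φ M t k * ((ζ τ - ζ t) ^ ((k : ℕ) + 1) / (((k : ℕ) + 1).factorial : ℂ)) := by
    funext τ
    exact Finset.sum_congr rfl fun k _ => by ring
  have hc : ∀ k : Fin (M + 1), ContDiff ℝ ∞ fun τ =>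
      (ζ τ - ζ t) ^ ((k : ℕ) + 1) / (((k : ℕ) + 1).factorial : ℂ) := fun k =>
    ((hζ.contDiff.sub contDiff_const).pow _).div_const _
  rw [← hd, ← iteratedDeriv_succ', he, iteratedDeriv_fun_sum fun k _ =>
    (contDiff_const.mul (hc k)).contDiffAt.of_le (by exact_mod_cast le_top)]
  simp only [Matrix.mulVec, dotProduct]
  refine Finset.sum_congr rfl fun k _ => ?_
  rw [iteratedDeriv_const_mul_field, iteratedDeriv_pow_div_factorial hζ.contDiff]
  simp only [bellMatrix, Matrix.of_apply]
  ring

/-- The interpolation conditions. -/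
theorem IsAnalyticClosedCurve.iteratedDeriv_normalized {ζ : ℝ → ℂ}
    (hζ : IsAnalyticClosedCurve ζ) (φ : ℝ → ℝ) (M : ℕ) (t : ℝ) {i : ℕ} (hi : i < M + 1) :
    iteratedDeriv i (fun τ => interpDeriv ζ φ M t (ζ τ) * deriv ζ τ *
      ((1 / ‖deriv ζ τ‖ : ℝ) : ℂ)) t = Complex.I * ((iteratedDeriv i φ t : ℝ) : ℂ) := by
  have hc1 : ContDiff ℝ ∞ fun τ => interpDeriv ζ φ M t (ζ τ) * deriv ζ τ := by
    refine ContDiff.mul (ContDiff.sum fun k _ => ?_) hζ.contDiff_deriv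
    exact contDiff_const.mul ((hζ.contDiff.sub contDiff_const).pow _)
  have hc2 : ContDiff ℝ ∞ fun τ => ((1 / ‖deriv ζ τ‖ : ℝ) : ℂ) :=
    Complex.ofRealCLM.contDiff.comp hζ.contDiff_inv_norm_deriv
  have hsys := congrFun (hζ.leibnizMatrix_mulVec_bellMatrix_mulVec_coeff φ M t) ⟨i, hi⟩
  simp only at hsys
  rw [iteratedDeriv_fun_mul (hc1.contDiffAt.of_le (by exact_mod_cast le_top))
    (hc2.contDiffAt.of_le (by exact_mod_cast le_top)), ← hsys]
  change _ = ∑ k : Fin (M + 1), leibnizMatrix ζ M t ⟨i, hi⟩ k *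
      (bellMatrix ζ M t).mulVec (coeff ζ φ M t) k
  -- Row `i` of the matrix is Leibniz's rule of order `i`, padded by zeros beyond `k = i`.
  have hext : ∑ k : Fin (M + 1), leibnizMatrix ζ M t ⟨i, hi⟩ k *
      (bellMatrix ζ M t).mulVec (coeff ζ φ M t) k =
      ∑ k ∈ Finset.range (M + 1), (if i < k then 0 else (i.choose k : ℂ) *
        ((iteratedDeriv (i - k) (fun s => 1 / ‖deriv ζ s‖) t : ℝ) : ℂ)) *
        iteratedDeriv k (fun τ => interpDeriv ζ φ M t (ζ τ) * deriv ζ τ) t := by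
    rw [← Fin.sum_univ_eq_sum_range (fun k => (if i < k then 0 else (i.choose k : ℂ) *
        ((iteratedDeriv (i - k) (fun s => 1 / ‖deriv ζ s‖) t : ℝ) : ℂ)) *
        iteratedDeriv k (fun τ => interpDeriv ζ φ M t (ζ τ) * deriv ζ τ) t)]
    refine Finset.sum_congr rfl fun k _ => ?_
    rw [hζ.iteratedDeriv_interpDeriv φ M t k]
    rfl
  rw [hext, ← Finset.sum_subset (Finset.range_subset_range.2 (by omega : i + 1 ≤ M + 1))]
  · refine Finset.sum_congr rfl fun k hk => ?_
    rw [if_neg (by have := Finset.mem_range.1 hk; omega),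
      iteratedDeriv_ofReal _ hζ.contDiff_inv_norm_deriv]
    ring
  · intro k _ hk
    rw [if_pos (by simpa using hk), zero_mul]

end HDI

namespace HDI

open Filter Topology
open scoped ContDiff

/-! ### Smooth dependence on the parameters -/

theorem contDiff_det {n : ℕ} {A : ℝ → Matrix (Fin n) (Fin n) ℂ}
    (hA : ∀ i j, ContDiff ℝ ∞ fun t => A t i j) : ContDiff ℝ ∞ fun t => (A t).det := by
  simp only [Matrix.det_apply']
  exact ContDiff.sum fun σ _ => contDiff_const.mul (contDiff_prod fun i _ => hA _ _)

theorem contDiff_adjugate {n : ℕ} {A : ℝ → Matrix (Fin n) (Fin n) ℂ}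
    (hA : ∀ i j, ContDiff ℝ ∞ fun t => A t i j) (i j : Fin n) :
    ContDiff ℝ ∞ fun t => (A t).adjugate i j := by
  simp only [Matrix.adjugate_apply]
  refine contDiff_det fun k l => ?_
  by_cases h : k = j
  · subst h; simpa using contDiff_const
  · simpa [Matrix.updateRow_ne h] using hA k l

theorem contDiff_iteratedDeriv {E : Type*} [NormedAddCommGroup E] [NormedSpace ℝ E] {f : ℝ → E}
    (hf : ContDiff ℝ ∞ f) (n : ℕ) : ContDiff ℝ ∞ (iteratedDeriv n f) := by
  induction n with
  | zero => simpa using hf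
  | succ n ih => rw [iteratedDeriv_succ]; exact (contDiff_infty_iff_deriv.1 ih).2

theorem contDiff_partialBell {x : ℕ → ℝ → ℂ} (hx : ∀ n, ContDiff ℝ ∞ (x n)) :
    ∀ j m : ℕ, ContDiff ℝ ∞ fun t => partialBell (fun n => x n t) j m
  | 0, m => by simpa only [partialBell] using contDiff_const
  | _ + 1, 0 => by simpa only [partialBell] using contDiff_const
  | j + 1, m + 1 => by
    simp only [partialBell]
    exact ContDiff.sum fun i _ =>
      (contDiff_const.mul (hx _)).mul (contDiff_partialBell hx j (m - i))

theorem contDiff_ofReal {f : ℝ → ℝ} (hf : ContDiff ℝ ∞ f) : ContDiff ℝ ∞ fun t => (f t : ℂ) :=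
  Complex.ofRealCLM.contDiff.comp hf

section

variable {ζ : ℝ → ℂ} {φ : ℝ → ℝ}

theorem IsAnalyticDensity.contDiff (hφ : IsAnalyticDensity φ) : ContDiff ℝ ∞ φ :=
  hφ.analytic.contDiff

/-- Cramer's rule: the inverse is the adjugate over a determinant that never vanishes, and all
entries are smooth in `t`. -/
theorem IsAnalyticClosedCurve.contDiff_coeff (hζ : IsAnalyticClosedCurve ζ)
    (hφ : IsAnalyticDensity φ) (M : ℕ) (k : Fin (M + 1)) :
    ContDiff ℝ ∞ fun t => coeff ζ φ M t k := by
  have hA : ∀ i j, ContDiff ℝ ∞ fun t => (leibnizMatrix ζ M t * bellMatrix ζ M t) i j := by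
    intro i j
    simp only [Matrix.mul_apply]
    refine ContDiff.sum fun l _ => ContDiff.mul ?_ ?_
    · simp only [leibnizMatrix, Matrix.of_apply]
      split_ifs
      · exact contDiff_const
      · exact contDiff_const.mul
          (contDiff_ofReal (contDiff_iteratedDeriv hζ.contDiff_inv_norm_deriv _))
    · simp only [bellMatrix, Matrix.of_apply]
      exact contDiff_partialBell (x := fun n => iteratedDeriv n ζ)
        (fun n => contDiff_iteratedDeriv hζ.contDiff n) _ _
  simp only [coeff, Matrix.mulVec, dotProduct, Matrix.inv_def, Ring.inverse_eq_inv']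
  refine ContDiff.sum fun l _ => ContDiff.mul ?_ ?_
  · simp only [Matrix.smul_apply, smul_eq_mul]
    exact ((contDiff_det hA).inv fun t => hζ.det_mul_ne_zero M t).mul (contDiff_adjugate hA _ _)
  · exact contDiff_const.mul (contDiff_ofReal (contDiff_iteratedDeriv hφ.contDiff _))

/-! ### The curve near the diagonal -/

theorem IsAnalyticClosedCurve.eq_iff (hζ : IsAnalyticClosedCurve ζ) (τ t : ℝ) :
    ζ τ = ζ t ↔ character 1 (τ - t) = 1 := by
  have h2 : (0 : ℝ) < 2 * π := by positivity
  rw [character_one_eq_one_iff]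
  constructor
  · intro h
    obtain ⟨m, hm, -⟩ := existsUnique_sub_zsmul_mem_Ico h2 τ 0
    obtain ⟨n, hn, -⟩ := existsUnique_sub_zsmul_mem_Ico h2 t 0
    rw [zero_add] at hm hn
    have := hζ.simple hm hn
      (by rw [hζ.periodic.sub_zsmul_eq, hζ.periodic.sub_zsmul_eq, h])
    refine ⟨m - n, ?_⟩
    simp only [zsmul_eq_mul] at this
    push_cast; linear_combination this
  · rintro ⟨k, hk⟩
    have : τ = t + k * (2 * π) := by linear_combination hk
    rw [this]; exact hζ.periodic.int_mul k t

theorem IsAnalyticClosedCurve.periodicSmooth_sub (hζ : IsAnalyticClosedCurve ζ) :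
    PeriodicSmooth fun p => ζ (p.2 + p.1) - ζ p.2 :=
  (PeriodicSmooth.of_translate hζ.contDiff hζ.periodic).sub
    (PeriodicSmooth.of_parameter hζ.contDiff)

/-- The chord divided by the corresponding chord of the unit circle. -/
theorem IsAnalyticClosedCurve.exists_chord_quotient (hζ : IsAnalyticClosedCurve ζ) :
    ∃ q, PeriodicSmooth q ∧ (∀ p, q p ≠ 0) ∧
      ∀ p : ℝ × ℝ, ζ (p.2 + p.1) - ζ p.2 = (character 1 p.1 - 1) * q p := by
  obtain ⟨q, hq, hu, h0⟩ := hζ.periodicSmooth_sub.exists_factor fun t => by simp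
  refine ⟨q, hq, ?_, hu⟩
  rintro ⟨s, t⟩ hne
  -- On the diagonal `q = ζ' / i`, nonzero by regularity; off it a zero of `q` would contradict
  -- injectivity of the curve.
  by_cases h : character 1 s = 1
  · rw [hq.eq_at_zero h, h0] at hne
    have hd : HasDerivAt (fun s => ζ (t + s) - ζ t) (deriv ζ (t + 0)) 0 := by
      have h1 : HasDerivAt (fun s : ℝ => ζ (t + s)) (deriv ζ (t + 0)) 0 :=
        HasDerivAt.comp_const_add t 0 (hζ.hasDerivAt (t + 0))
      exact h1.sub_const _
    rw [hd.deriv] at hne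
    rcases div_eq_zero_iff.1 hne with h2 | h2
    · exact hζ.regular _ h2
    · exact Complex.I_ne_zero h2
  · have h1 := hu (s, t)
    rw [hne, mul_zero, sub_eq_zero, hζ.eq_iff] at h1
    exact h (by simpa using h1)

theorem IsAnalyticClosedCurve.periodicSmooth_interpPoly (hζ : IsAnalyticClosedCurve ζ)
    (hφ : IsAnalyticDensity φ) (M : ℕ) :
    PeriodicSmooth fun p => interpPoly ζ φ M p.2 (ζ (p.2 + p.1)) := by
  refine PeriodicSmooth.sum _ fun k _ => PeriodicSmooth.mul ?_ (hζ.periodicSmooth_sub.pow _)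
  exact PeriodicSmooth.of_parameter ((hζ.contDiff_coeff hφ M k).div_const _)

theorem IsAnalyticClosedCurve.periodicSmooth_interpDeriv (hζ : IsAnalyticClosedCurve ζ)
    (hφ : IsAnalyticDensity φ) (M : ℕ) :
    PeriodicSmooth fun p => interpDeriv ζ φ M p.2 (ζ (p.2 + p.1)) * deriv ζ (p.2 + p.1) := by
  refine PeriodicSmooth.mul (PeriodicSmooth.sum _ fun k _ =>
    PeriodicSmooth.mul ?_ (hζ.periodicSmooth_sub.pow _)) ?_
  · exact PeriodicSmooth.of_parameter ((hζ.contDiff_coeff hφ M k).div_const _)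
  · exact PeriodicSmooth.of_translate hζ.contDiff_deriv (periodic_deriv hζ.periodic)

/-- The interpolation residual `(φ - Q) |ζ'|`, as a function of `(τ - t, t)`. -/
noncomputable def residual (ζ : ℝ → ℂ) (φ : ℝ → ℝ) (M : ℕ) (p : ℝ × ℝ) : ℝ :=
  (φ (p.2 + p.1) - traceQ ζ φ M (p.2 + p.1) p.2) * ‖deriv ζ (p.2 + p.1)‖

theorem IsAnalyticClosedCurve.residual_eq (hζ : IsAnalyticClosedCurve ζ) (φ : ℝ → ℝ) (M : ℕ)
    (p : ℝ × ℝ) : residual ζ φ M p = φ (p.2 + p.1) * ‖deriv ζ (p.2 + p.1)‖ -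
      (interpDeriv ζ φ M p.2 (ζ (p.2 + p.1)) * deriv ζ (p.2 + p.1)).im := by
  rw [residual, sub_mul, hζ.traceQ_mul_norm]

theorem IsAnalyticClosedCurve.periodicSmooth_residual (hζ : IsAnalyticClosedCurve ζ)
    (hφ : IsAnalyticDensity φ) (M : ℕ) :
    PeriodicSmooth fun p => (residual ζ φ M p : ℂ) := by
  simp only [hζ.residual_eq, Complex.ofReal_sub]
  refine PeriodicSmooth.sub ?_ (hζ.periodicSmooth_interpDeriv hφ M).im
  refine PeriodicSmooth.of_translate (a := fun τ => ((φ τ * ‖deriv ζ τ‖ : ℝ) : ℂ))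
    (contDiff_ofReal (hφ.contDiff.mul hζ.contDiff_norm_deriv)) fun τ => ?_
  beta_reduce
  rw [hφ.periodic τ, periodic_deriv hζ.periodic τ]

theorem IsAnalyticClosedCurve.analyticAt_interpDeriv (hζ : IsAnalyticClosedCurve ζ) (φ : ℝ → ℝ)
    (M : ℕ) (t τ : ℝ) :
    AnalyticAt ℝ (fun τ => interpDeriv ζ φ M t (ζ τ) * deriv ζ τ) τ := by
  have h1 := hζ.analytic τ (Set.mem_univ τ)
  have h2 := hζ.analytic.deriv τ (Set.mem_univ τ)
  unfold interpDeriv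
  fun_prop

/-- The residual is `-|ζ'|` times the imaginary part of `f' ζ' / |ζ'| - i φ`. The interpolation
conditions annihilate the derivatives of this difference of orders `0` to `M`. -/
theorem IsAnalyticClosedCurve.isBigO_residual (hζ : IsAnalyticClosedCurve ζ)
    (hφ : IsAnalyticDensity φ) (M : ℕ) (t : ℝ) :
    (fun s => (residual ζ φ M (s, t) : ℂ)) =O[𝓝 0] fun s : ℝ => s ^ (M + 1) := by
  let d : ℝ → ℂ := fun τ => interpDeriv ζ φ M t (ζ τ) * deriv ζ τ * ((1 / ‖deriv ζ τ‖ : ℝ) : ℂ)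
  let e : ℝ → ℂ := fun τ => Complex.I * (φ τ : ℂ)
  have hd : AnalyticAt ℝ d t := by
    refine (hζ.analyticAt_interpDeriv φ M t t).mul ?_
    have h1 : AnalyticAt ℝ (fun τ => 1 / ‖deriv ζ τ‖) t :=
      analyticAt_const.div (hζ.analyticAt_norm_deriv t) (hζ.norm_deriv_pos t).ne'
    exact (Complex.ofRealCLM.analyticAt _).comp h1
  have he : AnalyticAt ℝ e t := analyticAt_const.mul
    ((Complex.ofRealCLM.analyticAt _).comp (hφ.analytic t (Set.mem_univ t)))
  have hord : ((M + 1 : ℕ) : ℕ∞) ≤ analyticOrderAt (d - e) t := by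
    rw [natCast_le_analyticOrderAt_iff_iteratedDeriv_eq_zero (hd.sub he)]
    intro i hi
    rw [iteratedDeriv_sub hd.contDiffAt he.contDiffAt, hζ.iteratedDeriv_normalized φ M t hi,
      iteratedDeriv_const_mul_field, iteratedDeriv_ofReal _ hφ.contDiff, sub_self]
  obtain ⟨g, hg, hgev⟩ := (natCast_le_analyticOrderAt (hd.sub he)).1 hord
  have hO : (d - e) =O[𝓝 t] fun τ => (τ - t) ^ (M + 1) := by
    have h1 : (fun τ : ℝ => (τ - t) ^ (M + 1) • g τ) =O[𝓝 t]
        fun τ : ℝ => (τ - t) ^ (M + 1) • (1 : ℝ) :=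
      (Asymptotics.isBigO_refl (fun τ : ℝ => (τ - t) ^ (M + 1)) (𝓝 t)).smul
        (hg.continuousAt.isBigO_one ℝ)
    simp only [smul_eq_mul, mul_one] at h1
    exact h1.congr' (hgev.mono fun x hx => hx.symm) EventuallyEq.rfl
  have hn : (fun τ => ‖deriv ζ τ‖) =O[𝓝 t] fun _ => (1 : ℝ) :=
    hζ.contDiff_norm_deriv.continuous.continuousAt.isBigO_one ℝ
  have hO2 : (fun τ => ‖deriv ζ τ‖ * ‖(d - e) τ‖) =O[𝓝 t] fun τ => (τ - t) ^ (M + 1) := by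
    simpa using hn.mul hO.norm_left
  have htend : Tendsto (fun s : ℝ => t + s) (𝓝 0) (𝓝 t) := by
    have : Continuous fun s : ℝ => t + s := by fun_prop
    simpa using this.tendsto 0
  have hO3 := hO2.comp_tendsto htend
  simp only [Function.comp_def, add_sub_cancel_left] at hO3
  refine Asymptotics.IsBigO.trans (Asymptotics.IsBigO.of_bound 1 (Eventually.of_forall ?_)) hO3
  intro s
  rw [one_mul, Complex.norm_real, norm_mul, norm_norm, norm_norm, hζ.residual_eq]
  have hpos := hζ.norm_deriv_pos (t + s)
  have hre : φ (t + s) * ‖deriv ζ (t + s)‖ - (interpDeriv ζ φ M t (ζ (t + s)) *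
      deriv ζ (t + s)).im = -(‖deriv ζ (t + s)‖ * ((d - e) (t + s)).im) := by
    simp only [d, e, Pi.sub_apply, Complex.sub_im, Complex.im_mul_ofReal, Complex.I_im]
    field_simp; ring
  rw [hre, norm_neg, norm_mul, norm_norm]
  gcongr
  exact Complex.abs_im_le_norm _

/-! ### The regularized kernels -/

/-- The double-layer kernel of the unit circle is constant. This removes the only possible
singularity of the kernel for a general curve. -/
theorem im_I_mul_div_sub_one {w : ℂ} (hw : ‖w‖ = 1) (h1 : w ≠ 1) :
    (Complex.I * w / (w - 1)).im = 1 / 2 := by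
  have hw0 : w ≠ 0 := fun h => by simp [h] at hw
  have hww : w * (starRingEnd ℂ) w = 1 := by
    rw [Complex.mul_conj, Complex.normSq_eq_norm_sq, hw]; norm_num
  have hc : (starRingEnd ℂ) w = w⁻¹ := by
    exact eq_inv_of_mul_eq_one_right hww
  have h2 : w - 1 ≠ 0 := sub_ne_zero.2 h1
  have h3 : 1 - w ≠ 0 := sub_ne_zero.2 h1.symm
  have h4 : w / (w - 1) + (starRingEnd ℂ) (w / (w - 1)) = 1 := by
    rw [map_div₀, map_sub, map_one, hc]
    have : w⁻¹ / (w⁻¹ - 1) = 1 / (1 - w) := by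
      have : w⁻¹ - 1 = (1 - w) / w := by field_simp
      rw [this]; field_simp
    rw [this]
    rw [show 1 - w = -(w - 1) by ring, div_neg]
    rw [← sub_eq_add_neg, ← sub_div, div_self h2]
  rw [Complex.add_conj] at h4
  have h5 : 2 * (w / (w - 1)).re = 1 := by exact_mod_cast h4
  rw [mul_div_assoc, Complex.I_mul_im]
  linarith

theorem IsAnalyticClosedCurve.kernelP_mul_norm_of_ne (hζ : IsAnalyticClosedCurve ζ) (φ : ℝ → ℝ)
    (M : ℕ) {τ t : ℝ} (h : ζ τ ≠ ζ t) :
    kernelP ζ φ M τ t * ‖deriv ζ τ‖ = -(1 / (2 * π)) *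
      ((interpPoly ζ φ M t (ζ τ)).re * (deriv ζ τ / (ζ τ - ζ t)).im) := by
  have hne : ζ τ - ζ t ≠ 0 := sub_ne_zero.2 h
  have hin : inner ℝ (ζ t - ζ τ) (normal ζ τ) * ‖deriv ζ τ‖ =
      ((starRingEnd ℂ) (ζ t - ζ τ) * (-Complex.I * deriv ζ τ)).re := by
    rw [← hζ.normal_mul_norm, ← mul_assoc, Complex.re_mul_ofReal, Complex.inner, mul_comm (normal ζ τ)]
  have hdiv : (deriv ζ τ / (ζ τ - ζ t)).im =
      (deriv ζ τ * (starRingEnd ℂ) (ζ τ - ζ t)).im / ‖ζ t - ζ τ‖ ^ 2 := by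
    rw [norm_sub_rev, ← Complex.normSq_eq_norm_sq, div_eq_mul_inv, Complex.inv_def,
      ← mul_assoc, Complex.im_mul_ofReal, div_eq_mul_inv]
  rw [kernelP, if_neg h, traceP_eq, hdiv]
  have e : ((starRingEnd ℂ) (ζ t - ζ τ) * (-Complex.I * deriv ζ τ)).re =
      -(deriv ζ τ * (starRingEnd ℂ) (ζ τ - ζ t)).im := by
    simp; ring
  rw [e] at hin
  calc _ = 1 / (2 * π) * ((inner ℝ (ζ t - ζ τ) (normal ζ τ) * ‖deriv ζ τ‖) / ‖ζ t - ζ τ‖ ^ 2) *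
        (interpPoly ζ φ M t (ζ τ)).re := by ring
    _ = _ := by rw [hin]; ring

/-- The curvature value on the diagonal plays no role, being multiplied by `P(t,t) = 0`. -/
theorem kernelP_of_eq {M : ℕ} {τ t : ℝ} (h : ζ τ = ζ t) : kernelP ζ φ M τ t = 0 := by
  rw [kernelP, if_pos h, traceP_self, mul_zero]

/-- The double-layer part of the regularized integrand is smooth. -/
theorem IsAnalyticClosedCurve.exists_kernelP (hζ : IsAnalyticClosedCurve ζ)
    (hφ : IsAnalyticDensity φ) (M : ℕ) :
    ∃ A, PeriodicSmooth A ∧ ∀ s t,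
      ((kernelP ζ φ M (t + s) t * ‖deriv ζ (t + s)‖ : ℝ) : ℂ) = A (s, t) := by
  obtain ⟨q, hq, hq0, hu⟩ := hζ.exists_chord_quotient
  refine ⟨fun p => ((-(1 / (2 * π)) : ℝ) : ℂ) *
    ((((interpPoly ζ φ M p.2 (ζ (p.2 + p.1))).re : ℝ) : ℂ) *
      ((((deriv (fun s => q (s, p.2)) p.1 / q p).im : ℝ) : ℂ) + ((1 / 2 : ℝ) : ℂ))), ?_, ?_⟩
  · exact (PeriodicSmooth.const _).mul ((hζ.periodicSmooth_interpPoly hφ M).re.mul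
      ((hq.deriv_fst.div hq hq0).im.add (PeriodicSmooth.const _)))
  · intro s t
    by_cases h : ζ (t + s) = ζ t
    · rw [kernelP_of_eq h]
      simp [h, interpPoly_self]
    · have hw : character 1 s ≠ 1 := fun hw => h ((hζ.eq_iff _ _).2 (by simpa using hw))
      rw [hζ.kernelP_mul_norm_of_ne φ M h]
      have hd : deriv ζ (t + s) = Complex.I * character 1 s * q (s, t) +
          (character 1 s - 1) * deriv (fun s => q (s, t)) s := by
        have h1 : HasDerivAt (fun s : ℝ => ζ (t + s) - ζ t) (deriv ζ (t + s)) s :=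
          (HasDerivAt.comp_const_add t s (hζ.hasDerivAt (t + s))).sub_const _
        have h2 : HasDerivAt (fun s => q (s, t)) (deriv (fun s => q (s, t)) s) s :=
          ((hq.section_contDiff t).differentiable (by simp) s).hasDerivAt
        have h3 := ((hasDerivAt_character 1 s).sub_const 1).mul h2
        have h4 : (fun s : ℝ => ζ (t + s) - ζ t) = fun s => (character 1 s - 1) * q (s, t) :=
          funext fun s => hu (s, t)
        rw [h4] at h1
        have h5 := h1.unique h3
        rw [h5]; simp
      have hqn := hq0 (s, t)
      have hw' : character 1 s - 1 ≠ 0 := sub_ne_zero.2 hw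
      -- The logarithmic derivative of the chord splits into the smooth `q' / q` and the circle
      -- term, whose imaginary part is `1 / 2`.
      have hquot : deriv ζ (t + s) / (ζ (t + s) - ζ t) =
          deriv (fun s => q (s, t)) s / q (s, t) +
            Complex.I * character 1 s / (character 1 s - 1) := by
        rw [hu (s, t), hd]; field_simp; ring
      rw [hquot, Complex.add_im, im_I_mul_div_sub_one (norm_character 1 s) hw]
      push_cast; ring

/-- The single-layer part of the regularized integrand. -/
theorem IsAnalyticClosedCurve.exists_kernelQ (hζ : IsAnalyticClosedCurve ζ)
    (hφ : IsAnalyticDensity φ) (M : ℕ) :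
    ∃ B, PeriodicSmooth B ∧ ∀ s t,
      ((kernelQ ζ φ M (t + s) t * ‖deriv ζ (t + s)‖ : ℝ) : ℂ) = B (s, t) +
        ((-(1 / (2 * π)) : ℝ) : ℂ) *
          (((Real.log ‖character 1 s - 1‖ : ℝ) : ℂ) * (residual ζ φ M (s, t) : ℂ)) := by
  obtain ⟨q, hq, hq0, hu⟩ := hζ.exists_chord_quotient
  have hres0 : ∀ t, residual ζ φ M (0, t) = 0 := by
    intro t
    obtain ⟨c, hc⟩ := (hζ.isBigO_residual hφ M t).bound
    simpa using hc.self_of_nhds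
  -- `log |ζ τ - ζ t| = log |q| + log |e^{is} - 1|` off the diagonal, and the first summand is
  -- smooth. On the diagonal the vanishing residual makes both sides `0`.
  refine ⟨fun p => ((-(1 / (2 * π)) : ℝ) : ℂ) *
    (((Real.log ‖q p‖ : ℝ) : ℂ) * (residual ζ φ M p : ℂ)), ?_, ?_⟩
  · exact (PeriodicSmooth.const _).mul
      ((hq.log_norm hq0).mul (hζ.periodicSmooth_residual hφ M))
  · intro s t
    by_cases h : ζ (t + s) = ζ t
    · have hw : character 1 s = 1 := by simpa using (hζ.eq_iff _ _).1 h
      have hr : (residual ζ φ M (s, t) : ℂ) = 0 := by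
        rw [(hζ.periodicSmooth_residual hφ M).eq_at_zero hw, hres0]; simp
      rw [kernelQ, if_pos h]
      simp only [hr]; simp
    · have hw : character 1 s ≠ 1 := fun hw => h ((hζ.eq_iff _ _).2 (by simpa using hw))
      have hlog : Real.log ‖ζ t - ζ (t + s)‖ =
          Real.log ‖q (s, t)‖ + Real.log ‖character 1 s - 1‖ := by
        rw [norm_sub_rev, hu (s, t), norm_mul, Real.log_mul
          (norm_ne_zero_iff.2 (sub_ne_zero.2 hw)) (norm_ne_zero_iff.2 (hq0 _)), add_comm]
      rw [kernelQ, if_neg h, hlog]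
      simp only [residual]
      push_cast; ring

end

end HDI

namespace HDI

open Filter Topology MeasureTheory
open scoped ContDiff

/-! ### Green's identity on the curve -/

/-- This gives continuity, through the singular point, of the primitive used for Green's identity.
-/
theorem continuous_log_norm_mul : Continuous fun z : ℂ => ((Real.log ‖z‖ : ℝ) : ℂ) * z := by
  rw [continuous_iff_continuousAt]
  intro z
  rcases eq_or_ne z 0 with rfl | hz
  · rw [ContinuousAt, mul_zero, tendsto_zero_iff_norm_tendsto_zero]
    have h : Continuous fun z : ℂ => |‖z‖ * Real.log ‖z‖| :=
      (Real.continuous_mul_log.comp continuous_norm).abs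
    have h0 := h.tendsto 0
    simp only [norm_zero, zero_mul, abs_zero] at h0
    refine h0.congr fun z => ?_
    rw [norm_mul, Complex.norm_real, Real.norm_eq_abs, abs_mul, abs_norm, mul_comm]
  · exact (Complex.continuous_ofReal.continuousAt.comp
      (continuous_norm.continuousAt.log (norm_ne_zero_iff.2 hz))).mul continuousAt_id

theorem hasDerivAt_log_norm {u : ℝ → ℂ} {u' : ℂ} {τ : ℝ} (hu : HasDerivAt u u' τ)
    (h0 : u τ ≠ 0) : HasDerivAt (fun τ => Real.log ‖u τ‖) (u' / u τ).re τ := by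
  have hn : ‖u τ‖ ≠ 0 := norm_ne_zero_iff.2 h0
  have h1 := (hu.norm_sq.log (pow_ne_zero 2 hn)).div_const 2
  have e : (fun τ => Real.log (‖u τ‖ ^ 2) / 2) = fun τ => Real.log ‖u τ‖ := by
    funext τ; rw [Real.log_pow]; push_cast; ring
  simp only [e] at h1
  refine h1.congr_deriv ?_
  rw [Complex.inner, div_eq_mul_inv u', Complex.inv_def, ← mul_assoc, Complex.re_mul_ofReal,
    Complex.normSq_eq_norm_sq]
  field_simp

variable {ζ : ℝ → ℂ} {φ : ℝ → ℝ}

/-- The interpolating polynomial divided by `z - ζ t`. -/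
noncomputable def interpQuot (ζ : ℝ → ℂ) (φ : ℝ → ℝ) (M : ℕ) (t : ℝ) (z : ℂ) : ℂ :=
  ∑ k : Fin (M + 1), coeff ζ φ M t k / (((k : ℕ) + 1).factorial : ℂ) * (z - ζ t) ^ (k : ℕ)

/-- A primitive of `interpQuot`. -/
noncomputable def interpQuotPrim (ζ : ℝ → ℂ) (φ : ℝ → ℝ) (M : ℕ) (t : ℝ) (z : ℂ) : ℂ :=
  ∑ k : Fin (M + 1), coeff ζ φ M t k / (((k : ℕ) + 1).factorial : ℂ) *
    ((z - ζ t) ^ ((k : ℕ) + 1) / ((k : ℕ) + 1 : ℂ))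

theorem interpPoly_eq_mul (ζ : ℝ → ℂ) (φ : ℝ → ℝ) (M : ℕ) (t : ℝ) (z : ℂ) :
    interpPoly ζ φ M t z = (z - ζ t) * interpQuot ζ φ M t z := by
  simp only [interpPoly, interpQuot, Finset.mul_sum]
  exact Finset.sum_congr rfl fun k _ => by ring

theorem hasDerivAt_interpQuotPrim (ζ : ℝ → ℂ) (φ : ℝ → ℝ) (M : ℕ) (t : ℝ) (z : ℂ) :
    HasDerivAt (interpQuotPrim ζ φ M t) (interpQuot ζ φ M t z) z := by
  refine HasDerivAt.fun_sum fun k _ => ?_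
  have h := (((((hasDerivAt_id z).sub_const (ζ t)).pow ((k : ℕ) + 1)).div_const
    (((k : ℕ) : ℂ) + 1)).const_mul (coeff ζ φ M t k / (((k : ℕ) + 1).factorial : ℂ)))
  refine h.congr_deriv ?_
  have h4 : (((k : ℕ) : ℂ) + 1) ≠ 0 := by exact_mod_cast (k : ℕ).succ_ne_zero
  congr 1
  push_cast
  simp only [id, mul_one]
  rw [mul_div_assoc, mul_div_cancel₀ _ h4]

theorem continuous_interpQuot (ζ : ℝ → ℂ) (φ : ℝ → ℝ) (M : ℕ) (t : ℝ) :
    Continuous (interpQuot ζ φ M t) := by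
  unfold interpQuot; fun_prop

theorem IsAnalyticClosedCurve.kernelQ_mul_norm (hζ : IsAnalyticClosedCurve ζ) (φ : ℝ → ℝ)
    (M : ℕ) (τ t : ℝ) : kernelQ ζ φ M τ t * ‖deriv ζ τ‖ = green (ζ t) (ζ τ) * φ τ * ‖deriv ζ τ‖ -
      green (ζ t) (ζ τ) * (interpDeriv ζ φ M t (ζ τ) * deriv ζ τ).im := by
  rw [← hζ.traceQ_mul_norm, kernelQ, green]
  split_ifs with h
  -- `green` is `0` on the diagonal because `log 0 = 0`, so the identity holds there too.
  · simp [h]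
  · ring

/-- The logarithm of the modulus of a meromorphic function is locally integrable, so the zeros of
the chord need not be isolated by hand. -/
theorem IsAnalyticClosedCurve.intervalIntegrable_green_mul (hζ : IsAnalyticClosedCurve ζ) (t : ℝ)
    {f : ℝ → ℝ} (hf : Continuous f) (a b : ℝ) :
    IntervalIntegrable (fun τ => green (ζ t) (ζ τ) * f τ) volume a b := by
  have hm : MeromorphicOn (fun τ => ζ t - ζ τ) (Set.uIcc a b) := fun τ _ =>
    (analyticAt_const.sub (hζ.analytic τ (Set.mem_univ τ))).meromorphicAt
  have h1 := hm.intervalIntegrable_log_norm.const_mul (-(1 / (2 * π)))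
  exact h1.mul_continuousOn hf.continuousOn

theorem IsAnalyticClosedCurve.continuous_kernelP (hζ : IsAnalyticClosedCurve ζ)
    (hφ : IsAnalyticDensity φ) (M : ℕ) (t : ℝ) :
    Continuous fun τ => kernelP ζ φ M τ t * ‖deriv ζ τ‖ := by
  obtain ⟨A, hA, hAe⟩ := hζ.exists_kernelP hφ M
  have h : (fun τ => kernelP ζ φ M τ t * ‖deriv ζ τ‖) = fun τ => (A (τ - t, t)).re := by
    funext τ
    have := hAe (τ - t) t
    rw [add_sub_cancel] at this
    rw [← this, Complex.ofReal_re]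
  rw [h]
  exact Complex.continuous_re.comp (hA.smooth.continuous.comp (by fun_prop))

theorem IsAnalyticClosedCurve.continuous_interpDeriv (hζ : IsAnalyticClosedCurve ζ) (φ : ℝ → ℝ)
    (M : ℕ) (t : ℝ) :
    Continuous fun τ => interpDeriv ζ φ M t (ζ τ) * deriv ζ τ :=
  continuous_iff_continuousAt.2 fun τ => (hζ.analyticAt_interpDeriv φ M t τ).continuousAt

/-- The boundary integral form of Green's identity for the interpolant, which vanishes at the
target point. -/
theorem IsAnalyticClosedCurve.integral_green_interp (hζ : IsAnalyticClosedCurve ζ)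
    (hφ : IsAnalyticDensity φ) (M : ℕ) (t : ℝ) :
    ∫ τ in (0 : ℝ)..(2 * π), (green (ζ t) (ζ τ) * (interpDeriv ζ φ M t (ζ τ) * deriv ζ τ).im -
      kernelP ζ φ M τ t * ‖deriv ζ τ‖) = 0 := by
  have h2 : (0 : ℝ) < 2 * π := by positivity
  have hv := hζ.continuous_interpDeriv φ M t
  let D : ℝ → ℝ := fun τ => green (ζ t) (ζ τ) * (interpDeriv ζ φ M t (ζ τ) * deriv ζ τ).im -
      kernelP ζ φ M τ t * ‖deriv ζ τ‖
  have hint : ∀ a b, IntervalIntegrable D volume a b := fun a b =>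
    (hζ.intervalIntegrable_green_mul t (Complex.continuous_im.comp hv) a b).sub
      ((hζ.continuous_kernelP hφ M t).intervalIntegrable a b)
  -- By periodicity the integral may be taken over `[t, t + 2π]`, where the singularity lies only at
  -- the endpoints.
  have hper : Function.Periodic D (2 * π) := by
    intro τ
    obtain ⟨A, hA, hAe⟩ := hζ.exists_kernelP hφ M
    have h3 := hAe (τ - t) t
    have h4 := hAe (τ - t + 2 * π) t
    rw [add_sub_cancel] at h3
    rw [hA.periodic, show t + (τ - t + 2 * π) = τ + 2 * π by ring, ← h3] at h4
    simp only [D]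
    rw [hζ.periodic τ, periodic_deriv hζ.periodic τ]
    rw [periodic_deriv hζ.periodic τ] at h4
    rw [Complex.ofReal_inj.1 h4]
  -- With `u = ζ τ - ζ t`, the derivative of `log |u| Im f` contains the unwanted term `Im f Re
  -- (u'/u)`. Subtracting the primitive of `Im (f u'/u)` cancels it and leaves the `R^P` term `-Re f
  -- Im (u'/u)`.
  let Φ : ℝ → ℝ := fun τ => -(1 / (2 * π)) *
    ((((Real.log ‖ζ τ - ζ t‖ : ℝ) : ℂ) * (ζ τ - ζ t) * interpQuot ζ φ M t (ζ τ)).im -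
      (interpQuotPrim ζ φ M t (ζ τ)).im)
  have hΦc : Continuous Φ := by
    have hζc := hζ.contDiff.continuous
    have h3 : Continuous fun τ => ((Real.log ‖ζ τ - ζ t‖ : ℝ) : ℂ) * (ζ τ - ζ t) :=
      continuous_log_norm_mul.comp (hζc.sub continuous_const)
    have h4 : Continuous (interpQuotPrim ζ φ M t) :=
      continuous_iff_continuousAt.2 fun z => (hasDerivAt_interpQuotPrim ζ φ M t z).continuousAt
    exact continuous_const.mul ((Complex.continuous_im.comp
      (h3.mul ((continuous_interpQuot ζ φ M t).comp hζc))).sub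
      (Complex.continuous_im.comp (h4.comp hζc)))
  have hderiv : ∀ τ ∈ Set.Ioo t (t + 2 * π), HasDerivAt Φ (D τ) τ := by
    intro τ hτ
    have hne : ζ τ ≠ ζ t := by
      rw [Ne, hζ.eq_iff, character_one_eq_one_iff]
      rintro ⟨k, hk⟩
      have h3 : 0 < (k : ℝ) * (2 * π) := by rw [← hk]; linarith [hτ.1]
      have h4 : (k : ℝ) * (2 * π) < 1 * (2 * π) := by rw [← hk]; linarith [hτ.2]
      have h5 : (0 : ℝ) < k := pos_of_mul_pos_left h3 h2.le
      have h6 : (k : ℝ) < 1 := lt_of_mul_lt_mul_right h4 h2.le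
      have h7 : 0 < k := by exact_mod_cast h5
      have h8 : k < 1 := by exact_mod_cast h6
      omega
    have hu0 : ζ τ - ζ t ≠ 0 := sub_ne_zero.2 hne
    have hl := hasDerivAt_log_norm ((hζ.hasDerivAt τ).sub_const (ζ t)) hu0
    have hf := hζ.hasDerivAt_interpPoly_comp φ M t τ
    have hfi : HasDerivAt (fun τ => (interpPoly ζ φ M t (ζ τ)).im)
        (interpDeriv ζ φ M t (ζ τ) * deriv ζ τ).im τ :=
      (Complex.imCLM.hasFDerivAt.comp_hasDerivAt τ hf)
    have hP : HasDerivAt (fun τ => interpQuotPrim ζ φ M t (ζ τ))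
        (interpQuot ζ φ M t (ζ τ) * deriv ζ τ) τ :=
      (hasDerivAt_interpQuotPrim ζ φ M t (ζ τ)).comp τ (hζ.hasDerivAt τ)
    have hPi : HasDerivAt (fun τ => (interpQuotPrim ζ φ M t (ζ τ)).im)
        (interpQuot ζ φ M t (ζ τ) * deriv ζ τ).im τ :=
      (Complex.imCLM.hasFDerivAt.comp_hasDerivAt τ hP)
    have hall := ((hl.mul hfi).sub hPi).const_mul (-(1 / (2 * π)))
    have hΦ : Φ = fun τ => -(1 / (2 * π)) * (Real.log ‖ζ τ - ζ t‖ *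
        (interpPoly ζ φ M t (ζ τ)).im - (interpQuotPrim ζ φ M t (ζ τ)).im) := by
      funext τ
      simp only [Φ]
      rw [mul_assoc, ← interpPoly_eq_mul, Complex.im_ofReal_mul]
    rw [hΦ]
    refine hall.congr_deriv ?_
    simp only [D]
    rw [hζ.kernelP_mul_norm_of_ne φ M hne, green, norm_sub_rev (ζ t)]
    have hsplit : (interpQuot ζ φ M t (ζ τ) * deriv ζ τ).im =
        (interpPoly ζ φ M t (ζ τ)).re * (deriv ζ τ / (ζ τ - ζ t)).im +
        (interpPoly ζ φ M t (ζ τ)).im * (deriv ζ τ / (ζ τ - ζ t)).re := by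
      rw [← Complex.mul_im, interpPoly_eq_mul]
      congr 1; field_simp
    rw [hsplit]; ring
  have hFTC := intervalIntegral.integral_eq_sub_of_hasDerivAt_of_le
    (by linarith : t ≤ t + 2 * π) hΦc.continuousOn hderiv (hint _ _)
  have hΦp : Φ (t + 2 * π) = Φ t := by simp only [Φ, hζ.periodic t]
  rw [hΦp, sub_self] at hFTC
  have := hper.intervalIntegral_add_eq 0 t
  rw [zero_add] at this
  exact this.trans hFTC

theorem IsAnalyticClosedCurve.intervalIntegrable_kernelQ (hζ : IsAnalyticClosedCurve ζ)
    (hφ : IsAnalyticDensity φ) (M : ℕ) (t : ℝ) :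
    IntervalIntegrable (fun τ => kernelQ ζ φ M τ t * ‖deriv ζ τ‖) volume 0 (2 * π) := by
  have hv := hζ.continuous_interpDeriv φ M t
  simp only [hζ.kernelQ_mul_norm, mul_assoc]
  exact (hζ.intervalIntegrable_green_mul t
    (hφ.contDiff.continuous.mul hζ.contDiff_norm_deriv.continuous) 0 (2 * π)).sub
    (hζ.intervalIntegrable_green_mul t (Complex.continuous_im.comp hv) 0 (2 * π))

/-- The regularized representation of the single-layer operator. -/
theorem IsAnalyticClosedCurve.singleLayer_eq (hζ : IsAnalyticClosedCurve ζ)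
    (hφ : IsAnalyticDensity φ) (M : ℕ) (t : ℝ) :
    singleLayer ζ φ t = (∫ τ in (0 : ℝ)..(2 * π), kernelP ζ φ M τ t * ‖deriv ζ τ‖) +
      ∫ τ in (0 : ℝ)..(2 * π), kernelQ ζ φ M τ t * ‖deriv ζ τ‖ := by
  have hv := hζ.continuous_interpDeriv φ M t
  have h1 := hζ.intervalIntegrable_green_mul t (Complex.continuous_im.comp hv) 0 (2 * π)
  have h2 := (hζ.continuous_kernelP hφ M t).intervalIntegrable (μ := volume) 0 (2 * π)
  have h3 := hζ.integral_green_interp hφ M t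
  have h4 : IntervalIntegrable (fun τ => green (ζ t) (ζ τ) * φ τ * ‖deriv ζ τ‖) volume
      0 (2 * π) := by
    simp only [mul_assoc]
    exact hζ.intervalIntegrable_green_mul t
      (hφ.contDiff.continuous.mul hζ.contDiff_norm_deriv.continuous) 0 (2 * π)
  simp only [Function.comp_def] at h1
  rw [intervalIntegral.integral_sub h1 h2, sub_eq_zero] at h3
  simp only [hζ.kernelQ_mul_norm]
  rw [intervalIntegral.integral_sub h4 h1, ← h3, singleLayer]
  ring

end HDI

namespace HDI

open Filter Topology MeasureTheory
open scoped ContDiff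

/-! ### Error bounds for the two kernels -/

/-- A smooth family divisible by `(e^{is} - 1)^n` times the logarithm. -/
theorem exists_fourierDecay_log_mul {n : ℕ} (hn : 1 ≤ n) {F G : ℝ × ℝ → ℂ}
    (hG : PeriodicSmooth G) (hFG : ∀ p, F p = (character 1 p.1 - 1) ^ n * G p) :
    ∃ A, ∀ t ∈ Set.Icc (0 : ℝ) (2 * π), FourierDecay (n + 1) A fun s =>
      ((Real.log ‖character 1 s - 1‖ : ℝ) : ℂ) * F (s, t) := by
  obtain ⟨D, hD⟩ := fourierDecay_log_norm hn
  obtain ⟨K, hK⟩ := hG.fourierDecay (q := n + 1 + 2) (by omega)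
  refine ⟨D * K * decaySum 2, fun t ht => ?_⟩
  have := hD.mul (by omega) (hK t ht)
  simpa only [hFG, mul_assoc] using this

/-- Decay is measured in `s = τ - t`, whereas the grid is fixed in `τ`; translation invariance of
the decay bridges the two for every `t`, on the grid or not. -/
theorem exists_quadrature_bound {q : ℕ} (hq : 2 ≤ q) {f : ℝ → ℝ → ℝ} {W : ℝ × ℝ → ℂ}
    (hfW : ∀ s t, (f (t + s) t : ℂ) = W (s, t))
    (hW : ∃ A, ∀ t ∈ Set.Icc (0 : ℝ) (2 * π), FourierDecay q A fun s => W (s, t)) :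
    ∃ C, ∀ N : ℕ, 0 < N → ∀ t ∈ Set.Icc (0 : ℝ) (2 * π),
      |(∫ τ in (0 : ℝ)..(2 * π), f τ t) - trapezoid N fun τ => f τ t| ≤ C * mesh N ^ q := by
  obtain ⟨A, hA⟩ := hW
  refine ⟨2 * π * decaySum q / π ^ q * A, fun N hN t ht => ?_⟩
  have h1 := ((hA t ht).translate t).norm_quadErr_le hq hN
  have h2 : (fun τ => W (τ - t, t)) = fun τ => (f τ t : ℂ) := by
    funext τ
    rw [← hfW, add_sub_cancel]
  rwa [h2, quadErr_ofReal, Complex.norm_real, Real.norm_eq_abs] at h1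

variable {ζ : ℝ → ℂ} {φ : ℝ → ℝ}

theorem IsAnalyticClosedCurve.exists_kernelP_bound (hζ : IsAnalyticClosedCurve ζ)
    (hφ : IsAnalyticDensity φ) (M : ℕ) {q : ℕ} (hq : 2 ≤ q) :
    ∃ C, ∀ N : ℕ, 0 < N → ∀ t ∈ Set.Icc (0 : ℝ) (2 * π),
      |(∫ τ in (0 : ℝ)..(2 * π), kernelP ζ φ M τ t * ‖deriv ζ τ‖) -
        trapezoid N fun τ => kernelP ζ φ M τ t * ‖deriv ζ τ‖| ≤ C * mesh N ^ q := by
  obtain ⟨A, hA, hAe⟩ := hζ.exists_kernelP hφ M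
  exact exists_quadrature_bound hq (f := fun τ t => kernelP ζ φ M τ t * ‖deriv ζ τ‖) hAe
    (hA.fourierDecay hq)

theorem IsAnalyticClosedCurve.exists_residual_factor (hζ : IsAnalyticClosedCurve ζ)
    (hφ : IsAnalyticDensity φ) (M : ℕ) : ∃ G, PeriodicSmooth G ∧
      ∀ p : ℝ × ℝ, (residual ζ φ M p : ℂ) = (character 1 p.1 - 1) ^ (M + 1) * G p :=
  PeriodicSmooth.exists_pow_factor (M + 1) (hζ.periodicSmooth_residual hφ M) fun t =>
    (hζ.isBigO_residual hφ M t).mono nhdsWithin_le_nhds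

theorem exists_fourierDecay_smooth_add_log {n : ℕ} (hn : 1 ≤ n) {B F G : ℝ × ℝ → ℂ}
    (hB : PeriodicSmooth B) (hG : PeriodicSmooth G)
    (hFG : ∀ p, F p = (character 1 p.1 - 1) ^ n * G p) (c : ℂ) :
    ∃ A, ∀ t ∈ Set.Icc (0 : ℝ) (2 * π), FourierDecay (n + 1) A fun s => B (s, t) +
      c * (((Real.log ‖character 1 s - 1‖ : ℝ) : ℂ) * F (s, t)) := by
  obtain ⟨A₁, h₁⟩ := hB.fourierDecay (q := n + 1) (by omega)
  obtain ⟨A₂, h₂⟩ := exists_fourierDecay_log_mul hn hG hFG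
  exact ⟨_, fun t ht => (h₁ t ht).add ((h₂ t ht).const_mul c)⟩

/-- The exponent is `M + 1` for the zero of the residual plus one for the logarithm. It is `2m + 3`
for `M = 2m + 1`, but only `2m + 2` for `M = 2m`. -/
theorem IsAnalyticClosedCurve.exists_kernelQ_bound (hζ : IsAnalyticClosedCurve ζ)
    (hφ : IsAnalyticDensity φ) (M : ℕ) :
    ∃ C, ∀ N : ℕ, 0 < N → ∀ t ∈ Set.Icc (0 : ℝ) (2 * π),
      |(∫ τ in (0 : ℝ)..(2 * π), kernelQ ζ φ M τ t * ‖deriv ζ τ‖) -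
        trapezoid N fun τ => kernelQ ζ φ M τ t * ‖deriv ζ τ‖| ≤ C * mesh N ^ (M + 2) := by
  obtain ⟨B, hB, hBe⟩ := hζ.exists_kernelQ hφ M
  obtain ⟨G, hG, hFG⟩ := hζ.exists_residual_factor hφ M
  exact exists_quadrature_bound (by omega)
    (f := fun τ t => kernelQ ζ φ M τ t * ‖deriv ζ τ‖)
    (W := fun p => B p + ((-(1 / (2 * π)) : ℝ) : ℂ) *
          (((Real.log ‖character 1 p.1 - 1‖ : ℝ) : ℂ) * (residual ζ φ M p : ℂ))) hBe
    (exists_fourierDecay_smooth_add_log (by omega) hB hG hFG _)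

theorem trapezoid_add (N : ℕ) (f g : ℝ → ℝ) :
    trapezoid N (fun τ => f τ + g τ) = trapezoid N f + trapezoid N g := by
  simp only [trapezoid, Finset.sum_add_distrib, mul_add]

theorem singleLayerTrap_eq (ζ : ℝ → ℂ) (φ : ℝ → ℝ) (M N : ℕ) (t : ℝ) :
    singleLayerTrap ζ φ M N t = (trapezoid N fun τ => kernelP ζ φ M τ t * ‖deriv ζ τ‖) +
      trapezoid N fun τ => kernelQ ζ φ M τ t * ‖deriv ζ τ‖ := by
  rw [singleLayerTrap, traceP_self, zero_div, zero_add, ← trapezoid_add]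
  simp only [add_mul]

/-! ### The odd logarithmic term -/

theorem periodic_oddTerm (m : ℕ) (a t : ℝ) : Function.Periodic (oddTerm m a t) (2 * π) := by
  intro τ
  have h : (τ + 2 * π - t) / 2 = (τ - t) / 2 + π := by ring
  simp only [oddTerm, h, Real.sin_add_pi, Real.cos_add_pi, neg_sq]
  rw [Odd.neg_pow ⟨m, rfl⟩]
  ring

theorem oddTerm_sub (m : ℕ) (a t s : ℝ) :
    oddTerm m a t (t - s) = -oddTerm m a t (t + s) := by
  have h : (t - s - t) / 2 = -((t + s - t) / 2) := by ring
  simp only [oddTerm, h, Real.sin_neg, Real.cos_neg, neg_sq]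
  rw [Odd.neg_pow ⟨m, rfl⟩]
  ring

/-- No sign condition is needed, since `Real.log` is even and `log 0 = 0`. -/
theorem log_four_mul_sq (x : ℝ) : Real.log (4 * x ^ 2) = 2 * Real.log (2 * x) := by
  rw [show 4 * x ^ 2 = (2 * x) ^ 2 by ring, Real.log_pow]; push_cast; ring

theorem continuous_oddTerm (m : ℕ) (a t : ℝ) : Continuous (oddTerm m a t) := by
  have h : oddTerm m a t = fun τ => -(a / (4 * π)) * sin ((τ - t) / 2) ^ (2 * m) *
      cos ((τ - t) / 2) * ((2 * sin ((τ - t) / 2)) * Real.log (2 * sin ((τ - t) / 2))) := by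
    funext τ
    rw [oddTerm, log_four_mul_sq]; ring
  rw [h]
  have h2 : Continuous fun τ : ℝ => 2 * sin ((τ - t) / 2) := by fun_prop
  have h3 : Continuous fun τ : ℝ => -(a / (4 * π)) * sin ((τ - t) / 2) ^ (2 * m) *
      cos ((τ - t) / 2) := by fun_prop
  exact h3.mul (Real.continuous_mul_log.comp h2)

theorem integral_oddTerm (m : ℕ) (a t : ℝ) :
    ∫ τ in (0 : ℝ)..(2 * π), oddTerm m a t τ = 0 := by
  have h1 := (periodic_oddTerm m a t).intervalIntegral_add_eq 0 (t + -π)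
  rw [zero_add, show t + -π + 2 * π = t + π by ring] at h1
  have h2 : ∫ s in (-π)..π, oddTerm m a t (t + s) = ∫ τ in (t + -π)..(t + π), oddTerm m a t τ :=
    intervalIntegral.integral_comp_add_left _ _
  have h3 : ∫ s in (-π)..π, oddTerm m a t (t + -s) = ∫ s in (-π)..π, oddTerm m a t (t + s) := by
    have := intervalIntegral.integral_comp_neg (a := -π) (b := π)
      (fun s => oddTerm m a t (t + s))
    simpa using this
  simp only [← sub_eq_add_neg t, oddTerm_sub, intervalIntegral.integral_neg] at h3
  rw [h1, ← sub_eq_add_neg] at *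
  rw [← h2]
  linarith

theorem sum_range_add_eq {n : ℕ} {f : ℕ → ℝ} (hf : ∀ j, f (j + n) = f j) (c : ℕ) :
    ∑ j ∈ Finset.range n, f (j + c) = ∑ j ∈ Finset.range n, f j := by
  induction c with
  | zero => rfl
  | succ c ih =>
    rw [← ih]
    have h1 := Finset.sum_range_succ (fun j => f (j + c)) n
    have h2 := Finset.sum_range_succ' (fun j => f (j + c)) n
    rw [h1, add_comm n c, hf c] at h2
    simp only [zero_add, add_left_inj] at h2
    rw [h2]
    exact Finset.sum_congr rfl fun j _ => by congr 1; ring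

/-- Modulo `2π` the grid is symmetric about each of its own points, so oddness forces the sum to
equal its negative. -/
theorem trapezoid_oddTerm_node {N : ℕ} (hN : 0 < N) (m : ℕ) (a : ℝ) (k : ℕ) :
    trapezoid N (oddTerm m a (node N k)) = 0 := by
  have hN' : (N : ℝ) ≠ 0 := by positivity
  have h2N : (2 * N : ℝ) * mesh N = 2 * π := by rw [mesh]; field_simp
  have hper := periodic_oddTerm m a (node N k)
  set S := ∑ j ∈ Finset.range (2 * N), oddTerm m a (node N k) (node N j) with hS
  -- Reflection about `t_k` sends index `i` to `2k - i`. For `i = 2N - 1 - j` this is `j + 2k + 1`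
  -- modulo `2N`.
  have hrefl : S = -∑ j ∈ Finset.range (2 * N), oddTerm m a (node N k)
      (node N (j + (2 * k + 1))) := by
    rw [hS, ← Finset.sum_range_reflect, ← Finset.sum_neg_distrib]
    refine Finset.sum_congr rfl fun j hj => ?_
    have hj' := Finset.mem_range.1 hj
    have e1 : node N (2 * N - 1 - j) = node N k - (node N (j + 1 + k)) + 2 * π := by
      rw [← h2N]
      simp only [node]
      rw [Nat.sub_sub, Nat.cast_sub (by omega)]
      push_cast; ring
    have e2 : node N (j + (2 * k + 1)) = node N k + node N (j + 1 + k) := by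
      simp only [node]; push_cast; ring
    rw [e1, hper, oddTerm_sub, e2]
  have hshift := sum_range_add_eq (n := 2 * N)
    (f := fun j => oddTerm m a (node N k) (node N j)) (fun j => by
      have : node N (j + 2 * N) = node N j + 2 * π := by
        rw [← h2N]; simp only [node]; push_cast; ring
      simp only [this, hper (node N j)]) (2 * k + 1)
  rw [hshift, ← hS] at hrefl
  rw [trapezoid, ← hS, show S = 0 by linarith, mul_zero]

/-! ### The leading part of the residual for even order -/

/-- Zeros of an analytic function are isolated unless it vanishes locally, which is excluded as sine
and cosine have no common zero. -/
theorem eventually_sin_half_ne_zero (t x : ℝ) :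
    ∀ᶠ τ in 𝓝[≠] x, sin ((τ - t) / 2) ≠ 0 := by
  have ha : AnalyticAt ℝ (fun τ : ℝ => sin ((τ - t) / 2)) x := by fun_prop
  rcases ha.eventually_eq_zero_or_eventually_ne_zero with h | h
  · exfalso
    have hd : HasDerivAt (fun τ : ℝ => sin ((τ - t) / 2)) (cos ((x - t) / 2) * (1 / 2)) x :=
      ((((hasDerivAt_id x).sub_const t).div_const 2).sin)
    have h0 : HasDerivAt (fun _ : ℝ => (0 : ℝ)) (cos ((x - t) / 2) * (1 / 2)) x :=
      hd.congr_of_eventuallyEq (h.mono fun _ hy => hy.symm)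
    have hc := h0.unique (hasDerivAt_const x (0 : ℝ))
    have hs := h.self_of_nhds
    have := Real.sin_sq_add_cos_sq ((x - t) / 2)
    rw [hs, show cos ((x - t) / 2) = 0 by linarith] at this
    norm_num at this
  · exact h

theorem character_one_sub_one_eq (s : ℝ) : character 1 s - 1 =
    (sin (s / 2) : ℂ) * (2 * Complex.I * Complex.exp ((s / 2 : ℂ) * Complex.I)) := by
  have h1 : character 1 s = Complex.exp ((s / 2 : ℂ) * Complex.I) ^ 2 := by
    rw [character, ← Complex.exp_nat_mul]; push_cast; ring_nf
  have h2 : Complex.exp (-(s / 2 : ℂ) * Complex.I) * Complex.exp ((s / 2 : ℂ) * Complex.I) = 1 := by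
    rw [← Complex.exp_add]; simp
  rw [h1]
  push_cast
  rw [Complex.sin]
  linear_combination h2 - (Complex.exp (-(s / 2 : ℂ) * Complex.I) *
    Complex.exp ((s / 2 : ℂ) * Complex.I) - Complex.exp ((s / 2 : ℂ) * Complex.I) ^ 2) *
    Complex.I_sq

theorem log_norm_character_sub_one (s : ℝ) :
    Real.log ‖character 1 s - 1‖ = Real.log (4 * sin (s / 2) ^ 2) / 2 := by
  have h : ‖Complex.exp ((s / 2 : ℂ) * Complex.I)‖ = 1 := by
    have := Complex.norm_exp_ofReal_mul_I (s / 2)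
    push_cast at this; exact this
  rw [log_four_mul_sq, character_one_sub_one_eq, norm_mul, norm_mul, norm_mul, h,
    Complex.norm_real, Complex.norm_I]
  rw [Complex.norm_ofNat, mul_one, mul_one, mul_comm ‖_‖, Real.norm_eq_abs]
  rw [← Real.log_abs (2 * sin (s / 2)), abs_mul, abs_two]; ring

/-- The periodic factor that turns `(e^{is} - 1)^{2m+1}` into a multiple of
`sin^{2m+1}(s/2) cos(s/2)`. -/
noncomputable def halfAngleFactor (m : ℕ) (s : ℝ) : ℂ :=
  (character 1 s + 1) / 2 * character (-(m + 1)) s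

/-- The factor equals `cos (s/2) e^{-i(2m+1)s/2}`. The cosine compensates the sign change of the odd
half-angle power, so the product is `2π`-periodic; it keeps the product odd and equals `1` at `s =
0`. -/
theorem pow_mul_halfAngleFactor (m : ℕ) (s : ℝ) :
    (character 1 s - 1) ^ (2 * m + 1) * halfAngleFactor m s =
      (2 * Complex.I) ^ (2 * m + 1) *
        ((sin (s / 2) ^ (2 * m + 1) * cos (s / 2) : ℝ) : ℂ) := by
  set z := Complex.exp ((s / 2 : ℂ) * Complex.I) with hz
  set y := Complex.exp (-(s / 2 : ℂ) * Complex.I) with hy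
  have hzy : z * y = 1 := by rw [hz, hy, ← Complex.exp_add]; simp
  have h1 : character 1 s = z ^ 2 := by
    rw [character, hz, ← Complex.exp_nat_mul]; push_cast; ring_nf
  have h2 : character (-(m + 1)) s = y ^ (2 * m + 2) := by
    rw [character, hy, ← Complex.exp_nat_mul]; push_cast; ring_nf
  have hcos : ((cos (s / 2) : ℝ) : ℂ) = (z + y) / 2 := by
    push_cast; rw [Complex.cos]
  rw [character_one_sub_one_eq, ← hz, halfAngleFactor, h1, h2]
  push_cast at hcos ⊢
  rw [hcos, mul_pow, mul_pow]
  have e1 : z ^ (2 * m + 1) * ((z ^ 2 + 1) / 2 * y ^ (2 * m + 2)) = (z + y) / 2 := by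
    have e2 : z ^ 2 + 1 = z * (z + y) := by linear_combination -hzy
    calc z ^ (2 * m + 1) * ((z ^ 2 + 1) / 2 * y ^ (2 * m + 2))
        = (z * y) ^ (2 * m + 2) * ((z + y) / 2) := by rw [e2, mul_pow]; ring
      _ = _ := by rw [hzy, one_pow, one_mul]
  linear_combination (Complex.sin (s / 2) ^ (2 * m + 1) * (2 * Complex.I) ^ (2 * m + 1)) * e1

theorem periodicSmooth_halfAngleFactor (m : ℕ) :
    PeriodicSmooth fun p => halfAngleFactor m p.1 := by
  have h1 : PeriodicSmooth fun p => character 1 p.1 :=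
    PeriodicSmooth.of_section (contDiff_character _) (character_periodic _)
  have h2 : PeriodicSmooth fun p => character (-(m + 1)) p.1 :=
    PeriodicSmooth.of_section (contDiff_character _) (character_periodic _)
  exact ((h1.add (.const 1)).div (.const 2) fun _ => two_ne_zero).mul h2

theorem halfAngleFactor_zero (m : ℕ) : halfAngleFactor m 0 = 1 := by
  simp only [halfAngleFactor, character_at_zero]; norm_num

end HDI

/-! ### Subtraction of the odd term and assembly of the estimates. -/

namespace HDI

open Filter Topology MeasureTheory
open scoped ContDiff

variable {ζ : ℝ → ℂ} {φ : ℝ → ℝ}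

/-- Removing the odd logarithmic term from the even-order kernel gains one order. -/
theorem IsAnalyticClosedCurve.exists_odd_splitting (hζ : IsAnalyticClosedCurve ζ)
    (hφ : IsAnalyticDensity φ) (m : ℕ) :
    ∃ g : ℝ → ℝ → ℝ,
      (∀ t, AnalyticOnNhd ℝ (fun τ => g τ t) Set.univ) ∧
      (∀ τ t, g (τ + 2 * π) t = -g τ t) ∧
      (∀ τ t, (φ τ - traceQ ζ φ (2 * m) τ t) * ‖deriv ζ τ‖
        = sin ((τ - t) / 2) ^ (2 * m + 1) * g τ t) ∧
      ∃ C : ℝ, ∀ N : ℕ, 0 < N → ∀ t ∈ Set.Icc (0 : ℝ) (2 * π),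
        |(∫ τ in (0 : ℝ)..(2 * π),
            (kernelQ ζ φ (2 * m) τ t * ‖deriv ζ τ‖ - oddTerm m (g t t) t τ))
          - trapezoid N (fun τ =>
              kernelQ ζ φ (2 * m) τ t * ‖deriv ζ τ‖ - oddTerm m (g t t) t τ)|
          ≤ C * mesh N ^ (2 * m + 3) := by
  obtain ⟨G, hG, hFG⟩ := hζ.exists_residual_factor hφ (2 * m)
  obtain ⟨B, hB, hBe⟩ := hζ.exists_kernelQ hφ (2 * m)
  -- `X` is the residual divided by `sin^{2m+1}(s/2)`. It is smooth across the zeros of the sine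
  -- because it is written with `G`.
  let X : ℝ × ℝ → ℂ := fun p =>
    (2 * Complex.I * Complex.exp ((p.1 / 2 : ℂ) * Complex.I)) ^ (2 * m + 1) * G p
  have hXs : ContDiff ℝ ∞ X := by
    have h1 : ContDiff ℝ ∞ fun p : ℝ × ℝ => (p.1 : ℂ) :=
      Complex.ofRealCLM.contDiff.comp contDiff_fst
    have h2 : ContDiff ℝ ∞ fun p : ℝ × ℝ => Complex.exp ((p.1 / 2 : ℂ) * Complex.I) :=
      ((h1.div_const 2).mul contDiff_const).cexp
    exact ((contDiff_const.mul h2).pow _).mul hG.smooth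
  have hres : ∀ s t, (residual ζ φ (2 * m) (s, t) : ℂ) =
      ((sin (s / 2) ^ (2 * m + 1) : ℝ) : ℂ) * X (s, t) := by
    intro s t
    rw [hFG, character_one_sub_one_eq, mul_pow]
    simp only [X]; push_cast; ring
  have hresre : ∀ s t, residual ζ φ (2 * m) (s, t) =
      sin (s / 2) ^ (2 * m + 1) * (X (s, t)).re := by
    intro s t
    have := congrArg Complex.re (hres s t)
    rwa [Complex.ofReal_re, Complex.re_ofReal_mul] at this
  have hXc : ∀ t, Continuous fun s => X (s, t) := fun t =>
    hXs.continuous.comp (by fun_prop)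
  -- `X` is real wherever the sine is nonzero, hence at `s = 0` by continuity.
  have hXim : ∀ t, (X (0, t)).im = 0 := by
    intro t
    have h1 : Tendsto (fun s => (X (s, t)).im) (𝓝[≠] 0) (𝓝 (X (0, t)).im) :=
      ((Complex.continuous_im.comp (hXc t)).tendsto 0).mono_left nhdsWithin_le_nhds
    refine tendsto_nhds_unique h1 (tendsto_const_nhds.congr' ?_)
    filter_upwards [eventually_sin_half_ne_zero 0 0] with s hs
    have h2 := congrArg Complex.im (hres s t)
    rw [Complex.ofReal_im, Complex.im_ofReal_mul] at h2
    rw [sub_zero] at hs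
    exact ((mul_eq_zero.1 h2.symm).resolve_left (pow_ne_zero _ hs)).symm
  let g : ℝ → ℝ → ℝ := fun τ t => (X (τ - t, t)).re
  have hgdiag : ∀ t, g t t = (X (0, t)).re := fun t => by simp only [g, sub_self]
  have hfac : ∀ τ t, (φ τ - traceQ ζ φ (2 * m) τ t) * ‖deriv ζ τ‖
      = sin ((τ - t) / 2) ^ (2 * m + 1) * g τ t := by
    intro τ t
    have := hresre (τ - t) t
    simpa only [residual, add_sub_cancel] using this
  refine ⟨g, fun t x _ => ?_, fun τ t => ?_, hfac, ?_⟩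
  · have hcont : ContinuousAt (fun τ => g τ t) x :=
      (Complex.continuous_re.comp ((hXc t).comp (continuous_sub_right t))).continuousAt
    -- A quotient of analytic functions is meromorphic, and continuity makes its singularities
    -- removable.
    refine MeromorphicAt.analyticAt ?_ hcont
    have hnum : AnalyticAt ℝ (fun τ => φ τ * ‖deriv ζ τ‖ -
        (interpDeriv ζ φ (2 * m) t (ζ τ) * deriv ζ τ).im) x :=
      ((hφ.analytic x (Set.mem_univ x)).mul (hζ.analyticAt_norm_deriv x)).sub
        ((Complex.imCLM.analyticAt _).comp (hζ.analyticAt_interpDeriv φ (2 * m) t x))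
    have hden : AnalyticAt ℝ (fun τ : ℝ => sin ((τ - t) / 2) ^ (2 * m + 1)) x := by fun_prop
    refine (hnum.meromorphicAt.div hden.meromorphicAt).congr ?_
    filter_upwards [eventually_sin_half_ne_zero t x] with τ hτ
    have h1 := hfac τ t
    rw [sub_mul, hζ.traceQ_mul_norm] at h1
    rw [Pi.div_apply, h1, mul_div_cancel_left₀ _ (pow_ne_zero _ hτ)]
  · have h1 : Complex.exp ((((τ + 2 * π - t : ℝ) : ℂ) / 2) * Complex.I) =
        -Complex.exp ((((τ - t : ℝ) : ℂ) / 2) * Complex.I) := by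
      rw [show (((τ + 2 * π - t : ℝ) : ℂ) / 2) * Complex.I =
        (((τ - t : ℝ) : ℂ) / 2) * Complex.I + π * Complex.I by push_cast; ring,
        Complex.exp_add, Complex.exp_pi_mul_I]; ring
    have h2 : G (τ + 2 * π - t, t) = G (τ - t, t) := by
      rw [show τ + 2 * π - t = τ - t + 2 * π by ring, hG.periodic]
    simp only [g, X, h1, h2, mul_neg]
    rw [Odd.neg_pow ⟨m, rfl⟩, neg_mul, Complex.neg_re]
  -- Subtracting `σ_t` changes the smooth factor `G` of the residual into `K`, which vanishes at `s
  -- = 0` and so supplies one more factor `e^{is} - 1`.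
  · let K : ℝ × ℝ → ℂ := fun p =>
      G p - halfAngleFactor m p.1 * ((((X (0, p.2)).re : ℝ) : ℂ) / (2 * Complex.I) ^ (2 * m + 1))
    have hI : (2 * Complex.I) ^ (2 * m + 1) ≠ 0 :=
      pow_ne_zero _ (mul_ne_zero two_ne_zero Complex.I_ne_zero)
    have hK : PeriodicSmooth K := by
      refine hG.sub ((periodicSmooth_halfAngleFactor m).mul (PeriodicSmooth.of_parameter
        (a := fun t => (((X (0, t)).re : ℝ) : ℂ) / (2 * Complex.I) ^ (2 * m + 1)) ?_))
      exact (contDiff_ofReal (Complex.reCLM.contDiff.comp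
        (hXs.comp (contDiff_const.prodMk contDiff_id)))).div_const _
    have hK0 : ∀ t, K (0, t) = 0 := by
      intro t
      have h1 : (((X (0, t)).re : ℝ) : ℂ) = (2 * Complex.I) ^ (2 * m + 1) * G (0, t) := by
        have h2 : (((X (0, t)).re : ℝ) : ℂ) = X (0, t) :=
          Complex.ext (by simp) (by simp [hXim t])
        rw [h2]; simp [X]
      simp only [K, halfAngleFactor_zero, h1]
      rw [mul_div_cancel_left₀ _ hI]; ring
    obtain ⟨H, hH, hKH, -⟩ := hK.exists_factor hK0
    let F : ℝ × ℝ → ℂ := fun p => (residual ζ φ (2 * m) p : ℂ) -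
      ((sin (p.1 / 2) ^ (2 * m + 1) * cos (p.1 / 2) : ℝ) : ℂ) * (((X (0, p.2)).re : ℝ) : ℂ)
    have hF : ∀ p, F p = (character 1 p.1 - 1) ^ (2 * m + 2) * H p := by
      intro p
      have h1 := pow_mul_halfAngleFactor m p.1
      have h2 : F p = (character 1 p.1 - 1) ^ (2 * m + 1) * K p := by
        simp only [F, K]
        rw [hFG p, mul_sub, ← mul_assoc, h1]
        field_simp
      rw [h2, hKH]; ring
    refine exists_quadrature_bound (by omega)
      (f := fun τ t => kernelQ ζ φ (2 * m) τ t * ‖deriv ζ τ‖ - oddTerm m (g t t) t τ)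
      (W := fun p => B p + ((-(1 / (2 * π)) : ℝ) : ℂ) *
        (((Real.log ‖character 1 p.1 - 1‖ : ℝ) : ℂ) * F p)) (fun s t => ?_)
      (exists_fourierDecay_smooth_add_log (by omega) hB hH hF _)
    -- `log |e^{is} - 1|` is half of `log (4 sin²(s/2))`, which turns `1 / (2π)` into the `1 / (4π)`
    -- of `oddTerm`.
    rw [Complex.ofReal_sub, hBe, hgdiag, log_norm_character_sub_one]
    simp only [F, oddTerm, add_sub_cancel_left]
    push_cast
    have : (π : ℂ) ≠ 0 := by exact_mod_cast Real.pi_ne_zero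
    field_simp
    ring

theorem trapezoid_sub (N : ℕ) (f g : ℝ → ℝ) :
    trapezoid N (fun τ => f τ - g τ) = trapezoid N f - trapezoid N g := by
  simp only [trapezoid, Finset.sum_sub_distrib, mul_sub]

theorem node_mem_Icc {N k : ℕ} (hN : 0 < N) (hk : k < 2 * N) :
    node N k ∈ Set.Icc (0 : ℝ) (2 * π) := by
  have hN' : (0 : ℝ) < N := by exact_mod_cast hN
  have hk' : (k : ℝ) ≤ 2 * N := by exact_mod_cast hk.le
  have hm : 0 ≤ mesh N := by rw [mesh]; positivity
  refine ⟨by rw [node]; positivity, ?_⟩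
  calc node N k ≤ 2 * N * mesh N := mul_le_mul_of_nonneg_right hk' hm
    _ = 2 * π := by rw [mesh]; field_simp

/-- The error of the quadrature rule is the sum of the errors for the two kernels. -/
theorem IsAnalyticClosedCurve.abs_singleLayer_sub_le (hζ : IsAnalyticClosedCurve ζ)
    (hφ : IsAnalyticDensity φ) (M N : ℕ) (t : ℝ) {a b : ℝ}
    (hP : |(∫ τ in (0 : ℝ)..(2 * π), kernelP ζ φ M τ t * ‖deriv ζ τ‖) -
        trapezoid N fun τ => kernelP ζ φ M τ t * ‖deriv ζ τ‖| ≤ a)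
    (hQ : |(∫ τ in (0 : ℝ)..(2 * π), kernelQ ζ φ M τ t * ‖deriv ζ τ‖) -
        trapezoid N fun τ => kernelQ ζ φ M τ t * ‖deriv ζ τ‖| ≤ b) :
    |singleLayer ζ φ t - singleLayerTrap ζ φ M N t| ≤ a + b := by
  rw [hζ.singleLayer_eq hφ M t, singleLayerTrap_eq, add_sub_add_comm]
  exact (abs_add_le _ _).trans (add_le_add hP hQ)

end HDI

theorem mainTheorem5 (ζ : ℝ → ℂ) (φ : ℝ → ℝ)
    (hζ : HDI.IsAnalyticClosedCurve ζ) (hφ : HDI.IsAnalyticDensity φ) (m : ℕ) :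
    -- odd interpolation order `M = 2m + 1`, all target points
    (∃ C : ℝ, ∀ N : ℕ, 0 < N → ∀ t ∈ Set.Icc (0 : ℝ) (2 * Real.pi),
      |HDI.singleLayer ζ φ t - HDI.singleLayerTrap ζ φ (2 * m + 1) N t|
        ≤ C * HDI.mesh N ^ (2 * m + 3)) ∧
    -- even interpolation order `M = 2m`, target points on the grid
    (∃ C : ℝ, ∀ N : ℕ, 0 < N → ∀ k < 2 * N,
      |HDI.singleLayer ζ φ (HDI.node N k) - HDI.singleLayerTrap ζ φ (2 * m) N (HDI.node N k)|
        ≤ C * HDI.mesh N ^ (2 * m + 3)) ∧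
    -- the odd term behind the extra order for `M = 2m`
    (∃ g : ℝ → ℝ → ℝ,
      (∀ t, AnalyticOnNhd ℝ (fun τ => g τ t) Set.univ) ∧
      (∀ τ t, g (τ + 2 * Real.pi) t = -g τ t) ∧
      (∀ τ t, (φ τ - HDI.traceQ ζ φ (2 * m) τ t) * ‖deriv ζ τ‖
        = Real.sin ((τ - t) / 2) ^ (2 * m + 1) * g τ t) ∧
      (∀ t, Continuous (HDI.oddTerm m (g t t) t) ∧
        Function.Periodic (HDI.oddTerm m (g t t) t) (2 * Real.pi) ∧
        (∀ s, HDI.oddTerm m (g t t) t (t - s) = -HDI.oddTerm m (g t t) t (t + s)) ∧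
        ∫ τ in (0 : ℝ)..(2 * Real.pi), HDI.oddTerm m (g t t) t τ = 0) ∧
      (∀ N : ℕ, 0 < N → ∀ k < 2 * N,
        HDI.trapezoid N
          (HDI.oddTerm m (g (HDI.node N k) (HDI.node N k)) (HDI.node N k)) = 0) ∧
      (∃ C : ℝ, ∀ N : ℕ, 0 < N → ∀ t ∈ Set.Icc (0 : ℝ) (2 * Real.pi),
        |(∫ τ in (0 : ℝ)..(2 * Real.pi),
            (HDI.kernelQ ζ φ (2 * m) τ t * ‖deriv ζ τ‖ - HDI.oddTerm m (g t t) t τ))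
          - HDI.trapezoid N (fun τ =>
              HDI.kernelQ ζ φ (2 * m) τ t * ‖deriv ζ τ‖ - HDI.oddTerm m (g t t) t τ)|
          ≤ C * HDI.mesh N ^ (2 * m + 3))) := by
  obtain ⟨g, hg1, hg2, hg3, C₃, hC₃⟩ := hζ.exists_odd_splitting hφ m
  refine ⟨?_, ?_, g, hg1, hg2, hg3, fun t => ⟨HDI.continuous_oddTerm _ _ _,
    HDI.periodic_oddTerm _ _ _, HDI.oddTerm_sub _ _ _, HDI.integral_oddTerm _ _ _⟩,
    fun N hN k _ => HDI.trapezoid_oddTerm_node hN _ _ _, C₃, hC₃⟩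
  -- The smooth double-layer part allows any order; `q` is chosen to match the logarithmic part.
  · obtain ⟨C₁, h₁⟩ := hζ.exists_kernelP_bound hφ (2 * m + 1) (q := 2 * m + 3) (by omega)
    obtain ⟨C₂, h₂⟩ := hζ.exists_kernelQ_bound hφ (2 * m + 1)
    refine ⟨C₁ + C₂, fun N hN t ht => ?_⟩
    rw [add_mul]
    exact hζ.abs_singleLayer_sub_le hφ _ N t (h₁ N hN t ht) (h₂ N hN t ht)
  · obtain ⟨C₁, h₁⟩ := hζ.exists_kernelP_bound hφ (2 * m) (q := 2 * m + 3) (by omega)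
    refine ⟨C₁ + C₃, fun N hN k hk => ?_⟩
    have ht := HDI.node_mem_Icc hN hk
    rw [add_mul]
    refine hζ.abs_singleLayer_sub_le hφ _ N _ (h₁ N hN _ ht) ?_
    have h₃ := hC₃ N hN _ ht
    -- At a grid point the odd term has zero integral and zero trapezoidal sum, so the error of the
    -- remainder is the error of the whole kernel.
    rwa [HDI.trapezoid_sub, HDI.trapezoid_oddTerm_node hN, sub_zero,
      intervalIntegral.integral_sub (hζ.intervalIntegrable_kernelQ hφ (2 * m) _)
        ((HDI.continuous_oddTerm _ _ _).intervalIntegrable _ _), HDI.integral_oddTerm,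
      sub_zero] at h₃
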